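/- Let $2\le k\le n$. Digraphs are finite, without loops and without parallel arcs (opposite arcs $xy$, $yx$ are allowed). For a digraph $D$ of order $n$, the complement $D^c$ has the same vertices, and for distinct vertices $x,y$ the arc $xy$ belongs to $D^c$ if and only if it does not belong to $D$. For a vertex set $S$ with $|S|=k$ let $\lambda_S(D)$ be the maximum number of pairwise arc-disjoint strong (that is, strongly connected) subgraphs of $D$ whose vertex sets contain $S$, and let the strong subgraph $k$-arc-connectivity be $\lambda_k(D)=\min\{\lambda_S(D) : S\subseteq V(D),\ |S|=k\}$. Let $\lambda(D)$ be the arc-connectivity of $D$, the least number of arcs whose deletion leaves a digraph that is not strong. Then for every digraph $D$ of order $n$: (i) $0\le \lambda_k(D)+\lambda_k(D^c)\le n-1$, and the lower bound holds with equality if and only if $\lambda(D)=\lambda(D^c)=0$. (ii) $0\le \lambda_k(D)\,\lambda_k(D^c)\le \left(\frac{n-1}{2}\right)^2$, and the lower bound holds with equality if and only if $\lambda(D)=0$ or $\lambda(D^c)=0$. All four bounds are sharp: for all $2\le k\le n$ each of the two lower bounds is attained by some digraph of order $n$; the upper bound in (i) is attained by some digraph of order $n$ for all $2\le k\le n$ except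 possibly when $k=n\in\{4,6\}$; and the upper bound in (ii) is attained by some digraph of order $n$ for all odd $n$ and all $2\le k\le n$. -/

import Mathlib

namespace Digraph

/-- A digraph without loops. Parallel arcs cannot occur, since the arcs are given by a relation;
opposite arcs `xy` and `yx` may both be present. -/
def Loopless {V : Type*} (D : Digraph V) : Prop :=
  ∀ x, ¬ D.Adj x x

/-- The complement digraph: for distinct `x`, `y`, the arc `xy` is present iff it is absent
from `D`. (Mathlib's `Dᶜ` would have all the loops that `D` lacks.) -/
def complement {V : Type*} (D : Digraph V) : Digraph V where
  Adj x y := x ≠ y ∧ ¬ D.Adj x y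

/-- A digraph is strong if every vertex can be reached from every vertex along arcs. -/
def IsStrong {V : Type*} (D : Digraph V) : Prop :=
  ∀ x y, Relation.ReflTransGen D.Adj x y

/-- The spanning subdigraph obtained by deleting a set `X` of arcs. -/
def deleteArcs {V : Type*} (D : Digraph V) (X : Finset (V × V)) : Digraph V where
  Adj x y := D.Adj x y ∧ (x, y) ∉ X

/-- The arc-connectivity `λ(D)` (for at least two vertices): the least number of arcs of `D`
whose deletion leaves a digraph that is not strong. -/
noncomputable def arcConnectivity {V : Type*} (D : Digraph V) : ℕ :=
  sInf {m : ℕ | ∃ X : Finset (V × V),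
    (∀ a ∈ X, D.Adj a.1 a.2) ∧ X.card = m ∧ ¬ (D.deleteArcs X).IsStrong}

/-- A subgraph of a digraph: some of its vertices, and some of its arcs between these. -/
structure Subdigraph {V : Type*} (D : Digraph V) where
  /-- the vertices of the subgraph -/
  verts : Set V
  /-- the arcs of the subgraph -/
  Adj : V → V → Prop
  adj_sub : ∀ {x y : V}, Adj x y → D.Adj x y
  fst_mem : ∀ {x y : V}, Adj x y → x ∈ verts
  snd_mem : ∀ {x y : V}, Adj x y → y ∈ verts

/-- A subgraph is strong if it has a vertex and each of its vertices can be reached from each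
of its vertices along arcs of the subgraph. -/
def Subdigraph.IsStrong {V : Type*} {D : Digraph V} (H : D.Subdigraph) : Prop :=
  H.verts.Nonempty ∧ ∀ x ∈ H.verts, ∀ y ∈ H.verts, Relation.ReflTransGen H.Adj x y

/-- Two subgraphs are arc-disjoint if they have no arc in common. -/
def Subdigraph.ArcDisjoint {V : Type*} {D : Digraph V} (H K : D.Subdigraph) : Prop :=
  ∀ x y, ¬ (H.Adj x y ∧ K.Adj x y)

/-- `λ_S(D)`: the maximum number of pairwise arc-disjoint strong subgraphs of `D` containing `S`
(`S` has at least two vertices, `D` finitely many). -/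
noncomputable def localStrongArcConnectivity {V : Type*} (D : Digraph V) (S : Finset V) : ℕ :=
  sSup {p : ℕ | ∃ H : Fin p → D.Subdigraph,
    (∀ i, (H i).IsStrong ∧ ∀ v ∈ S, v ∈ (H i).verts) ∧
    ∀ i j, i ≠ j → (H i).ArcDisjoint (H j)}

/-- The strong subgraph `k`-arc-connectivity `λ_k(D)`: the minimum of `λ_S(D)` over all
`k`-element vertex sets `S` (`2 ≤ k ≤ n`). -/
noncomputable def strongArcConnectivity {V : Type*} (k : ℕ) (D : Digraph V) : ℕ :=
  sInf {m : ℕ | ∃ S : Finset V, S.card = k ∧ D.localStrongArcConnectivity S = m}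

end Digraph

/-! Upper bounds: every member of a packing on S uses an arc leaving a given vertex v of S, because
|S| ≥ 2 and the member is strong. So λ_k is at most every out-degree, and the out-degrees of v in D
and in its complement add up to n - 1. The product bound is then the inequality of the means.

Lower bounds: λ_k(D) > 0 and λ(D) > 0 both say that D is strong
(`strongArcConnectivity_eq_zero_iff`, `arcConnectivity_eq_zero_iff`), and a transitive tournament
and its complement are both not strong.

Upper bounds attained: the complete digraph must carry n - 1 arc-disjoint strong subgraphs on every
S. For odd n, Walecki's rotated zigzags decompose it into n - 1 Hamiltonian cycles; half of these
form a digraph which is extremal for the product. For even n > k, a vertex v outside S is removed,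
the remaining odd complete digraph is decomposed, and the star at v is one more subgraph. For even n
= k ≥ 8, Tillson's theorem is needed.

Tillson's theorem is proved by doubling (`PairedCycles.double`). A decomposition of order m, in
which some cycles come in inverse pairs, is lifted to V × Bool. An unpaired cycle lifts to two
cycles, a pair to two pairs, and one chosen pair together with the arcs inside the fibres to five
cycles. Lifting a pair is a problem about walks on a cyclic strip with m columns and two rows. Its
solutions are tables of period two, checked at one small m and extended by inserting two columns at
a time (`Strip.IsCyclicOn.insert`). -/

/-- The point `y` is reached from `x` by iterating `f`. -/
def Reaches {V : Type*} (f : V → V) (x y : V) : Prop := ∃ t : ℕ, f^[t] x = y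

theorem Reaches.refl {V : Type*} (f : V → V) (x : V) : Reaches f x x := ⟨0, rfl⟩

theorem Reaches.step {V : Type*} (f : V → V) (x : V) : Reaches f x (f x) := ⟨1, rfl⟩

theorem Reaches.trans {V : Type*} {f : V → V} {x y z : V} :
    Reaches f x y → Reaches f y z → Reaches f x z := by
  rintro ⟨s, rfl⟩ ⟨t, rfl⟩
  exact ⟨t + s, Function.iterate_add_apply f t s x⟩

theorem Reaches.iterate {V : Type*} (f : V → V) (x : V) (t : ℕ) : Reaches f x (f^[t] x) := ⟨t, rfl⟩

/-- Simulation: if `φ` turns each step of `f` into a walk of `g`, it turns walks into walks. The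
invariant `p` confines the hypothesis to the points that matter. -/
theorem Reaches.map {V W : Type*} {f : V → V} {g : W → W} (φ : V → W) (p : V → Prop)
    (hp : ∀ x, p x → p (f x)) (h : ∀ x, p x → Reaches g (φ x) (φ (f x))) {x y : V} (hx : p x)
    (hxy : Reaches f x y) : Reaches g (φ x) (φ y) := by
  obtain ⟨t, rfl⟩ := hxy
  induction t generalizing x with
  | zero => exact Reaches.refl _ _
  | succ t ih => exact (h x hx).trans (ih (hp x hx))

/-- The map `f` is a single directed cycle through all points of `V`. -/
def IsOneCycle {V : Type*} (f : V → V) : Prop := ∀ x y, Reaches f x y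

/-! ### Walks on a cyclic strip with two rows -/

namespace Strip

/-- A rule tells in each cell `(i, ε)` whether to stay in column `i`, or to go right or left,
and the row to enter. -/
abbrev Rule := ℕ → Bool → Option Bool × Bool

/-- The column next to `i`, among `m` columns in cyclic order. -/
def shift (m : ℕ) (d : Option Bool) (i : ℕ) : ℕ :=
  match d with
  | none => i
  | some true => if i + 1 = m then 0 else i + 1
  | some false => if i = 0 then m - 1 else i - 1

def move (m : ℕ) (τ : Rule) (v : ℕ × Bool) : ℕ × Bool :=
  (shift m (τ v.1 v.2).1 v.1, (τ v.1 v.2).2)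

def IsCyclicOn (m : ℕ) (τ : Rule) : Prop :=
  ∀ i < m, ∀ ε, Reaches (move m τ) (0, false) (i, ε) ∧ Reaches (move m τ) (i, ε) (0, false)

theorem shift_lt {m : ℕ} (hm : 0 < m) (d : Option Bool) {i : ℕ} (hi : i < m) :
    shift m d i < m := by
  unfold shift
  rcases d with _ | _ | _
  · exact hi
  all_goals dsimp only; split_ifs <;> omega

/-- The walk through two new columns, numbered 1 and 2, which stops outside of them. -/
def gapMove (a b : Bool → Option Bool × Bool) (s : ℕ × Bool) : ℕ × Bool :=
  if s.1 = 1 then (shift 4 (a s.2).1 1, (a s.2).2)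
  else if s.1 = 2 then (shift 4 (b s.2).1 2, (b s.2).2) else s

/-- Two new columns with rules `a`, `b` can be inserted between columns with rules `l`, `r`. -/
def Insertable (l a b r : Bool → Option Bool × Bool) : Prop :=
  (∀ ε, (l ε).1 = some true → (gapMove a b)^[4] (1, (l ε).2) = (3, (l ε).2)) ∧
  (∀ ε, (r ε).1 = some false → (gapMove a b)^[4] (2, (r ε).2) = (0, (r ε).2)) ∧
  ∀ ε, ∀ o ∈ [1, 2], ∃ δ,
    ((l δ).1 = some true ∧ ∃ t < 4, (gapMove a b)^[t] (1, (l δ).2) = (o, ε)) ∨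
    ((r δ).1 = some false ∧ ∃ t < 4, (gapMove a b)^[t] (2, (r δ).2) = (o, ε))

instance (l a b r : Bool → Option Bool × Bool) : Decidable (Insertable l a b r) := by
  unfold Insertable; infer_instance

section Insert

variable {m q : ℕ} {τ : Rule}

/-- The column which has the number `o` in the walk through the new columns `q`, `q + 1`. -/
def gapColumn (m q o : ℕ) : ℕ := if q + o = m + 3 then 0 else q + o - 1

/-- The new number of the old column `i`. -/
def newColumn (q i : ℕ) : ℕ := if i < q then i else i + 2

theorem gapMove_le (a b : Bool → Option Bool × Bool) {s : ℕ × Bool} (hs : s.1 ≤ 3) :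
    (gapMove a b s).1 ≤ 3 := by
  unfold gapMove
  split_ifs
  · exact Nat.lt_succ_iff.mp (shift_lt (by norm_num) _ (by norm_num))
  · exact Nat.lt_succ_iff.mp (shift_lt (by norm_num) _ (by norm_num))
  · exact hs

theorem reaches_gapMove (hq : 1 ≤ q) (hqm : q ≤ m) {s : ℕ × Bool} (hs : s.1 ≤ 3) :
    Reaches (move (m + 2) τ) (gapColumn m q s.1, s.2)
      (gapColumn m q (gapMove (τ q) (τ (q + 1)) s).1, (gapMove (τ q) (τ (q + 1)) s).2) := by
  obtain ⟨o, ε⟩ := s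
  by_cases h1 : o = 1
  · subst h1
    have hc : gapColumn m q 1 = q := by unfold gapColumn; split_ifs <;> omega
    refine ⟨1, ?_⟩
    simp only [Function.iterate_one, move, hc, gapMove, if_true, Prod.mk.injEq, and_true]
    rcases (τ q ε).1 with _ | _ | _
    · exact hc.symm
    · rw [show shift 4 (some false) 1 = 0 from rfl]
      simp only [shift, gapColumn]; split_ifs <;> omega
    · rw [show shift 4 (some true) 1 = 2 from rfl]
      simp only [shift, gapColumn]; split_ifs <;> omega
  by_cases h2 : o = 2
  · subst h2
    have hc : gapColumn m q 2 = q + 1 := by unfold gapColumn; split_ifs <;> omega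
    refine ⟨1, ?_⟩
    simp only [Function.iterate_one, move, hc, gapMove, if_true, Prod.mk.injEq, and_true,
      show (2 : ℕ) ≠ 1 by norm_num, if_false]
    rcases (τ (q + 1) ε).1 with _ | _ | _
    · exact hc.symm
    · rw [show shift 4 (some false) 2 = 1 from rfl]
      simp only [shift, gapColumn]; split_ifs <;> first | omega | simp_all
    · rw [show shift 4 (some true) 2 = 3 from rfl]
      simp only [shift, gapColumn]; split_ifs <;> omega
  · have : gapMove (τ q) (τ (q + 1)) (o, ε) = (o, ε) := by simp [gapMove, h1, h2]
    rw [this]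
    exact Reaches.refl _ _

theorem reaches_gapMove_iterate (hq : 1 ≤ q) (hqm : q ≤ m) (t : ℕ) {s : ℕ × Bool}
    (hs : s.1 ≤ 3) :
    Reaches (move (m + 2) τ) (gapColumn m q s.1, s.2)
      (gapColumn m q ((gapMove (τ q) (τ (q + 1)))^[t] s).1,
        ((gapMove (τ q) (τ (q + 1)))^[t] s).2) :=
  Reaches.map (f := gapMove (τ q) (τ (q + 1))) (fun s => (gapColumn m q s.1, s.2))
    (fun s => s.1 ≤ 3) (fun _ h => gapMove_le _ _ h) (fun _ h => reaches_gapMove hq hqm h) hs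
    (Reaches.iterate _ _ t)

/-- Only the moves across the border where the new columns are placed change. Such a move becomes a
detour through the gap which leaves it on the far side in the row where it entered, so it ends in
the cell where the old move ended. -/
theorem reaches_newColumn (hq : 1 ≤ q) (hqm : q ≤ m) (hper : ∀ i, q ≤ i → τ (i + 2) = τ i)
    (hins : Insertable (τ (q - 1)) (τ q) (τ (q + 1)) (τ (if q = m then 0 else q)))
    {v : ℕ × Bool} (hv : v.1 < m) :
    Reaches (move (m + 2) τ) (newColumn q v.1, v.2)
      (newColumn q (move m τ v).1, (move m τ v).2) := by
  obtain ⟨i, ε⟩ := v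
  simp only at hv
  have hτ : τ (newColumn q i) = τ i := by
    unfold newColumn; split_ifs with h
    · rfl
    · exact hper i (by omega)
  have hfirst : move (m + 2) τ (newColumn q i, ε)
      = (shift (m + 2) (τ i ε).1 (newColumn q i), (τ i ε).2) := by simp [move, hτ]
  by_cases hr : i + 1 = q ∧ (τ i ε).1 = some true
  · obtain ⟨hi, hd⟩ := hr
    have hi' : q - 1 = i := by omega
    have h4 := hins.1 ε (by rw [hi']; exact hd)
    rw [hi'] at h4
    have hw := reaches_gapMove_iterate (τ := τ) hq hqm 4 (s := (1, (τ i ε).2)) (by norm_num)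
    rw [h4] at hw
    have e1 : shift (m + 2) (τ i ε).1 (newColumn q i) = gapColumn m q 1 := by
      rw [hd]; simp only [shift, newColumn, gapColumn]; split_ifs <;> omega
    have e2 : newColumn q (move m τ (i, ε)).1 = gapColumn m q 3 := by
      simp only [move, hd, shift, newColumn, gapColumn]; split_ifs <;> omega
    rw [e2]
    refine (Reaches.step _ _).trans ?_
    rw [hfirst, e1]
    exact hw
  by_cases hl : i = (if q = m then 0 else q) ∧ (τ i ε).1 = some false
  · obtain ⟨hi, hd⟩ := hl
    have h4 := hins.2.1 ε (by rw [← hi]; exact hd)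
    rw [← hi] at h4
    have hw := reaches_gapMove_iterate (τ := τ) hq hqm 4 (s := (2, (τ i ε).2)) (by norm_num)
    rw [h4] at hw
    have e1 : shift (m + 2) (τ i ε).1 (newColumn q i) = gapColumn m q 2 := by
      rw [hd]; simp only [shift, newColumn, gapColumn]; split_ifs at * <;> omega
    have e2 : newColumn q (move m τ (i, ε)).1 = gapColumn m q 0 := by
      simp only [move, hd, shift, newColumn, gapColumn]; split_ifs at * <;> omega
    rw [e2]
    refine (Reaches.step _ _).trans ?_
    rw [hfirst, e1]
    exact hw
  · have : (newColumn q (move m τ (i, ε)).1, (move m τ (i, ε)).2)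
        = move (m + 2) τ (newColumn q i, ε) := by
      rw [hfirst]
      simp only [move, Prod.mk.injEq, and_true]
      rcases hd : (τ i ε).1 with _ | _ | _
      · rfl
      · simp only [hd, and_true] at hl
        simp only [shift, newColumn]; split_ifs at * <;> omega
      · simp only [hd, and_true] at hr
        simp only [shift, newColumn]; split_ifs at * <;> omega
    rw [this]
    exact Reaches.step _ _

/-- The old closed walk survives with detours, and the last clause of `Insertable` puts every new
cell on one of these detours. The border may be the seam `q = m`, where the column to the right is
column 0. -/
theorem IsCyclicOn.insert (h : IsCyclicOn m τ) (hq : 1 ≤ q) (hqm : q ≤ m)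
    (hper : ∀ i, q ≤ i → τ (i + 2) = τ i)
    (hins : Insertable (τ (q - 1)) (τ q) (τ (q + 1)) (τ (if q = m then 0 else q))) :
    IsCyclicOn (m + 2) τ := by
  have hm : 0 < m := by omega
  have hzero : newColumn q 0 = 0 := by simp [newColumn]; omega
  have key : ∀ {x y : ℕ × Bool}, x.1 < m → Reaches (move m τ) x y →
      Reaches (move (m + 2) τ) (newColumn q x.1, x.2) (newColumn q y.1, y.2) := fun hx hxy =>
    Reaches.map (fun v => (newColumn q v.1, v.2)) (fun v => v.1 < m)
      (fun v hv => shift_lt hm _ hv) (fun v hv => reaches_newColumn hq hqm hper hins hv) hx hxy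
  have hold : ∀ i < m, ∀ ε,
      Reaches (move (m + 2) τ) (0, false) (newColumn q i, ε) ∧
      Reaches (move (m + 2) τ) (newColumn q i, ε) (0, false) := by
    intro i hi ε
    have h1 := key (x := (0, false)) hm (h i hi ε).1
    have h2 := key (x := (i, ε)) hi (h i hi ε).2
    simp only [hzero] at h1 h2
    exact ⟨h1, h2⟩
  have hnew : ∀ o ∈ [1, 2], ∀ ε,
      Reaches (move (m + 2) τ) (0, false) (gapColumn m q o, ε) ∧
      Reaches (move (m + 2) τ) (gapColumn m q o, ε) (0, false) := by
    intro o ho ε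
    obtain ⟨δ, ⟨hd, t, ht, hto⟩ | ⟨hd, t, ht, hto⟩⟩ := hins.2.2 ε o ho
    · have h4 := hins.1 δ hd
      have hw := reaches_gapMove_iterate (τ := τ) hq hqm t (s := (1, (τ (q - 1) δ).2))
        (by norm_num)
      rw [hto] at hw
      have ho3 : o ≤ 3 := by simp at ho; omega
      have hw' := reaches_gapMove_iterate (τ := τ) hq hqm (4 - t) (s := (o, ε)) ho3
      -- The gap has four cells and `gapMove` fixes the cells outside, so four steps complete a
      -- crossing; the `4 - t` steps left lead from the new cell to the exit.
      rw [← hto, ← Function.iterate_add_apply, show 4 - t + t = 4 by omega, h4, hto] at hw'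
      have s1 := hold (q - 1) (by omega) δ
      have s2 := hold (if q = m then 0 else q) (by split_ifs <;> omega) (τ (q - 1) δ).2
      have e1 : newColumn q (q - 1) = q - 1 := by simp only [newColumn]; split_ifs <;> omega
      have e2 : newColumn q (if q = m then 0 else q) = gapColumn m q 3 := by
        simp only [newColumn, gapColumn]; split_ifs <;> omega
      have e3 : move (m + 2) τ (q - 1, δ) = (gapColumn m q 1, (τ (q - 1) δ).2) := by
        simp only [move, hd, shift, gapColumn, Prod.mk.injEq, and_true]; split_ifs <;> omega
      rw [e1] at s1
      rw [e2] at s2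
      have h3 := Reaches.step (move (m + 2) τ) (q - 1, δ)
      rw [e3] at h3
      exact ⟨(s1.1.trans h3).trans hw, hw'.trans s2.2⟩
    · have h4 := hins.2.1 δ hd
      set p := if q = m then 0 else q with hp
      have hw := reaches_gapMove_iterate (τ := τ) hq hqm t (s := (2, (τ p δ).2))
        (by norm_num)
      rw [hto] at hw
      have ho3 : o ≤ 3 := by simp at ho; omega
      have hw' := reaches_gapMove_iterate (τ := τ) hq hqm (4 - t) (s := (o, ε)) ho3
      rw [← hto, ← Function.iterate_add_apply, show 4 - t + t = 4 by omega, h4, hto] at hw'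
      have hpm : p < m := by rw [hp]; split_ifs <;> omega
      have s1 := hold p hpm δ
      have s2 := hold (q - 1) (by omega) (τ p δ).2
      have e1 : newColumn q (q - 1) = gapColumn m q 0 := by
        simp only [newColumn, gapColumn]; split_ifs <;> omega
      have hτ : τ (newColumn q p) = τ p := by
        unfold newColumn; split_ifs with h
        · rfl
        · exact hper p (by omega)
      have e3 : move (m + 2) τ (newColumn q p, δ) = (gapColumn m q 2, (τ p δ).2) := by
        have : move (m + 2) τ (newColumn q p, δ)
            = (shift (m + 2) (τ p δ).1 (newColumn q p), (τ p δ).2) := by simp only [move, hτ]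
        rw [this, hd, Prod.mk.injEq]
        refine ⟨?_, rfl⟩
        simp only [shift, gapColumn, newColumn]
        rw [hp]; split_ifs <;> first | omega | simp_all
      rw [e1] at s2
      have h3 := Reaches.step (move (m + 2) τ) (newColumn q p, δ)
      rw [e3] at h3
      exact ⟨(s1.1.trans h3).trans hw, hw'.trans s2.2⟩
  intro i hi ε
  by_cases h1 : i = q
  · have := hnew 1 (by simp) ε
    rwa [show gapColumn m q 1 = i by simp only [gapColumn]; split_ifs <;> omega] at this
  by_cases h2 : i = q + 1
  · have := hnew 2 (by simp) ε
    rwa [show gapColumn m q 2 = i by simp only [gapColumn]; split_ifs <;> omega] at this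
  have := hold (if i < q then i else i - 2) (by split_ifs <;> omega) ε
  rwa [show newColumn q (if i < q then i else i - 2) = i by
    simp only [newColumn]; split_ifs <;> omega] at this

end Insert

/-- The rule given by a table of the columns `0, …, c + 1`, continued with period 2 from
column `c` on. -/
def tableRule (c : ℕ) (T : List ℕ) : Rule := fun i ε =>
  -- Code of a move: `k % 2` is the row entered; `k / 2` is 0 for staying, 1 for going right and 2
  -- for going left.
  let k := T.getD (2 * (if i < c then i else c + (i - c) % 2) + ε.toNat) 0
  (if k / 2 = 0 then none else some (k / 2 == 1), k % 2 == 1)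

theorem tableRule_reduce (c : ℕ) (T : List ℕ) (i : ℕ) :
    tableRule c T i = tableRule c T (if i < c then i else c + (i - c) % 2) := by
  have h : (if (if i < c then i else c + (i - c) % 2) < c then
      (if i < c then i else c + (i - c) % 2)
      else c + ((if i < c then i else c + (i - c) % 2) - c) % 2)
      = if i < c then i else c + (i - c) % 2 := by split_ifs <;> omega
  unfold tableRule
  rw [h]

theorem tableRule_add_two (c : ℕ) (T : List ℕ) {i : ℕ} (hi : c ≤ i) :
    tableRule c T (i + 2) = tableRule c T i := by
  rw [tableRule_reduce c T i, tableRule_reduce c T (i + 2)]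
  congr 1
  split_ifs <;> omega

theorem tableRule_add_two_mul (c : ℕ) (T : List ℕ) {i : ℕ} (hi : c ≤ i) (k : ℕ) :
    tableRule c T (i + 2 * k) = tableRule c T i := by
  induction k with
  | zero => rfl
  | succ k ih => 
    rw [← ih]
    exact tableRule_add_two c T (i := i + 2 * k) (by omega)

/-- A table rule which is cyclic on `b` columns is cyclic on `b + 2 k` columns. -/
theorem isCyclicOn_tableRule {c : ℕ} {T : List ℕ} {b s : ℕ} (hs : s < 2) (hb : c + 1 + s ≤ b)
    (hc : IsCyclicOn b (tableRule c T))
    (hins : Insertable (tableRule c T (b - s - 1)) (tableRule c T (b - s))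
      (tableRule c T (b - s + 1)) (tableRule c T (if s = 0 then 0 else b - s))) (k : ℕ) :
    IsCyclicOn (b + 2 * k) (tableRule c T) := by
  induction k with
  | zero => exact hc
  | succ k ih =>
    -- The columns go in at the seam (`s = 0`) or before the last column (`s = 1`). By periodicity
    -- the rules around the border are the same for all `k`, so a single check of `Insertable`
    -- suffices.
    refine ih.insert (q := b - s + 2 * k) (by omega) (by omega)
      (fun i hi => tableRule_add_two c T (by omega)) ?_
    rw [show b - s + 2 * k - 1 = b - s - 1 + 2 * k by omega,
      show b - s + 2 * k + 1 = b - s + 1 + 2 * k by omega,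
      tableRule_add_two_mul c T (by omega), tableRule_add_two_mul c T (by omega),
      tableRule_add_two_mul c T (by omega)]
    rcases Nat.eq_zero_or_pos s with rfl | h
    · simpa using hins
    · rw [if_neg (by omega)] at hins
      rw [if_neg (by omega), tableRule_add_two_mul c T (by omega)]
      exact hins

/-- The decidable form of `IsCyclicOn`. -/
def IsCyclicWithin (m : ℕ) (τ : Rule) : Prop :=
  ∀ i < m, ∀ ε, (∃ t < 2 * m, (move m τ)^[t] (0, false) = (i, ε)) ∧
    ∃ t < 2 * m + 1, (move m τ)^[t] (i, ε) = (0, false)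

instance (m : ℕ) (τ : Rule) : Decidable (IsCyclicWithin m τ) := by
  unfold IsCyclicWithin; infer_instance

theorem IsCyclicWithin.isCyclicOn {m : ℕ} {τ : Rule} (h : IsCyclicWithin m τ) :
    IsCyclicOn m τ := fun i hi ε =>
  ⟨let ⟨t, _, ht⟩ := (h i hi ε).1; ⟨t, ht⟩, let ⟨t, _, ht⟩ := (h i hi ε).2; ⟨t, ht⟩⟩

end Strip

/-! ### Tables of cyclic rules -/

namespace Strip

/-- Five rules (the first five rows) and four rules (the last four rows), each of which gives
directed Hamiltonian cycles in a blown-up cycle of odd length. -/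
def oddTable : List (List ℕ) :=
  [[1, 2, 1, 3, 2, 0, 1, 2, 1, 2, 1, 2],
   [2, 3, 2, 4, 3, 2, 3, 5, 3, 0, 3, 0],
   [3, 5, 5, 2, 1, 4, 2, 0, 2, 5, 2, 5],
   [4, 0, 3, 0, 5, 3, 4, 3, 4, 3, 4, 3],
   [5, 4, 4, 5, 4, 5, 5, 4, 5, 4, 5, 4],
   [2, 5, 5, 2, 2, 5, 2, 5, 2, 5, 2, 5],
   [4, 2, 4, 3, 5, 3, 4, 3, 4, 3, 4, 3],
   [5, 3, 2, 4, 3, 4, 5, 2, 3, 4, 5, 2],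
   [3, 4, 3, 5, 4, 2, 3, 4, 5, 2, 3, 4]]

/-- The counterpart of `oddTable` for cycles of even length. -/
def evenTable : List (List ℕ) :=
  [[2, 3, 3, 2, 2, 3, 2, 3, 2, 3, 2, 3, 2, 3, 2, 3],
   [3, 2, 2, 5, 3, 2, 3, 5, 3, 2, 4, 2, 1, 2, 1, 2],
   [4, 5, 1, 4, 4, 0, 5, 0, 5, 0, 3, 5, 4, 5, 3, 4],
   [1, 4, 4, 3, 5, 4, 1, 4, 1, 4, 1, 4, 3, 4, 4, 5],
   [5, 0, 5, 0, 1, 5, 4, 2, 4, 5, 5, 0, 5, 0, 5, 0],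
   [2, 5, 5, 2, 2, 5, 2, 5, 2, 5, 2, 5, 2, 5, 2, 5],
   [4, 2, 4, 3, 5, 3, 4, 3, 4, 3, 4, 3, 4, 3, 4, 3],
   [3, 4, 2, 5, 3, 4, 5, 2, 3, 4, 5, 2, 3, 4, 5, 2],
   [5, 3, 3, 4, 4, 2, 3, 4, 5, 2, 3, 4, 5, 2, 3, 4]]

theorem tableRule_succ_reduce (c : ℕ) (T : List ℕ) (i : ℕ) :
    tableRule c T (i + 1) = tableRule c T ((if i < c then i else c + (i - c) % 2) + 1) := by
  rw [tableRule_reduce c T (i + 1),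
    tableRule_reduce c T ((if i < c then i else c + (i - c) % 2) + 1)]
  congr 1
  split_ifs <;> omega

/-- On a table of `c + 2` columns and at the seam of `b` columns, `σ` undoes `τ`. -/
def Undoes (c b : ℕ) (σ τ : Rule) : Prop :=
  (∀ i < c + 2, ∀ ε, (τ i ε).1 ≠ none) ∧
  (∀ i < c + 2, ∀ ε, (τ i ε).1 = some true → σ (i + 1) (τ i ε).2 = (some false, ε)) ∧
  (∀ i < c + 2, ∀ ε, (τ (i + 1) ε).1 = some false → σ i (τ (i + 1) ε).2 = (some true, ε)) ∧
  (∀ ε, (τ (b - 1) ε).1 = some true → σ 0 (τ (b - 1) ε).2 = (some false, ε)) ∧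
  (∀ ε, (τ 0 ε).1 = some false → σ (b - 1) (τ 0 ε).2 = (some true, ε))

instance (c b : ℕ) (σ τ : Rule) : Decidable (Undoes c b σ τ) := by
  unfold Undoes; infer_instance

/-- Being inverse is a local condition on two neighbouring columns, so periodicity reduces it to the
columns of the table and the seam. -/
theorem Undoes.move_move {c b : ℕ} {S T : List ℕ} (hb : c + 1 ≤ b)
    (h : Undoes c b (tableRule c S) (tableRule c T)) (k : ℕ) {i : ℕ} (hi : i < b + 2 * k)
    (ε : Bool) :
    move (b + 2 * k) (tableRule c S) (move (b + 2 * k) (tableRule c T) (i, ε)) = (i, ε) := by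
  obtain ⟨h1, h2, h3, h4, h5⟩ := h
  have hlast : ∀ T : List ℕ, tableRule c T (b + 2 * k - 1) = tableRule c T (b - 1) := fun T => by
    rw [show b + 2 * k - 1 = b - 1 + 2 * k by omega]
    exact tableRule_add_two_mul c T (by omega) k
  have hred : ∀ i, (if i < c then i else c + (i - c) % 2) < c + 2 := fun i => by
    split_ifs <;> omega
  rcases hd : (tableRule c T i ε).1 with _ | _ | _
  · rw [tableRule_reduce] at hd
    exact absurd hd (h1 _ (hred i) ε)
  · rcases Nat.eq_zero_or_pos i with rfl | hpos
    · have := h5 ε hd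
      rw [← hlast] at this
      simp only [move, hd, shift, if_true, this]
      rw [if_pos (by omega)]
    · obtain ⟨j, rfl⟩ : ∃ j, i = j + 1 := ⟨i - 1, by omega⟩
      have := h3 _ (hred j) ε (by rw [← tableRule_succ_reduce]; exact hd)
      rw [← tableRule_succ_reduce, ← tableRule_reduce] at this
      simp only [move, hd, shift, Nat.add_eq_zero_iff, one_ne_zero, and_false, if_false,
        Nat.add_sub_cancel, this]
      rw [if_neg (by omega)]
  · by_cases hl : i + 1 = b + 2 * k
    · have hi' : i = b + 2 * k - 1 := by omega
      have hτ : tableRule c T i = tableRule c T (b - 1) := by rw [hi', hlast]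
      have := h4 ε (by rw [← hτ]; exact hd)
      rw [← hτ] at this
      simp only [move, hd, shift, hl, if_true, this]
      rw [hi']
    · have := h2 _ (hred i) ε (by rw [← tableRule_reduce]; exact hd)
      rw [← tableRule_succ_reduce, ← tableRule_reduce] at this
      simp only [move, hd, shift, hl, if_false, this, Nat.add_eq_zero_iff, one_ne_zero, and_false,
        Nat.add_sub_cancel]

theorem tableRule_ne {c : ℕ} {S T : List ℕ}
    (h : ∀ i < c + 2, ∀ ε, tableRule c S i ε ≠ tableRule c T i ε) (i : ℕ) (ε : Bool) :
    tableRule c S i ε ≠ tableRule c T i ε := by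
  rw [tableRule_reduce c S, tableRule_reduce c T]
  exact h _ (by split_ifs <;> omega) ε

/-- The place of a row among the last four rows of a table. -/
def fourIndex (s : Bool × Bool) : ℕ := 5 + 2 * s.1.toNat + s.2.toNat

/-- The rows of a table are cyclic rules with pairwise different moves in each cell, and the last
four rows are two pairs of inverse rules. -/
structure IsGood (m c : ℕ) (T : List (List ℕ)) : Prop where
  cyclic : ∀ j < 9, IsCyclicOn m (tableRule c (T.getD j []))
  five : ∀ a b : Fin 5, a ≠ b → ∀ i ε,
    tableRule c (T.getD a []) i ε ≠ tableRule c (T.getD b []) i ε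
  four : ∀ a b : Bool × Bool, a ≠ b → ∀ i ε,
    tableRule c (T.getD (fourIndex a) []) i ε ≠ tableRule c (T.getD (fourIndex b) []) i ε
  undo : ∀ s, ∀ i < m, ∀ ε, move m (tableRule c (T.getD (fourIndex (s, false)) []))
    (move m (tableRule c (T.getD (fourIndex (s, true)) [])) (i, ε)) = (i, ε)
  moves : ∀ s i ε, (tableRule c (T.getD (fourIndex s) []) i ε).1 ≠ none

theorem isGood_of_table {c b : ℕ} {T : List (List ℕ)} (hb : c + 1 ≤ b)
    (h1 : ∀ j < 9, IsCyclicWithin b (tableRule c (T.getD j [])))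
    (h2 : ∀ j < 9, ∃ s < 2, c + 1 + s ≤ b ∧ Insertable (tableRule c (T.getD j []) (b - s - 1))
      (tableRule c (T.getD j []) (b - s)) (tableRule c (T.getD j []) (b - s + 1))
      (tableRule c (T.getD j []) (if s = 0 then 0 else b - s)))
    (h3 : ∀ a b : Fin 5, a ≠ b → ∀ i < c + 2, ∀ ε,
      tableRule c (T.getD a []) i ε ≠ tableRule c (T.getD b []) i ε)
    (h4 : ∀ a b : Bool × Bool, a ≠ b → ∀ i < c + 2, ∀ ε,
      tableRule c (T.getD (fourIndex a) []) i ε ≠ tableRule c (T.getD (fourIndex b) []) i ε)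
    (h5 : ∀ s, Undoes c b (tableRule c (T.getD (fourIndex (s, false)) []))
      (tableRule c (T.getD (fourIndex (s, true)) [])))
    (h6 : ∀ s, ∀ i < c + 2, ∀ ε, (tableRule c (T.getD (fourIndex s) []) i ε).1 ≠ none) (k : ℕ) :
    IsGood (b + 2 * k) c T where
  cyclic j hj := by
    obtain ⟨s, hs, hcs, hins⟩ := h2 j hj
    exact isCyclicOn_tableRule hs hcs (h1 j hj).isCyclicOn hins k
  five a b hab i ε := tableRule_ne (h3 a b hab) i ε
  four a b hab i ε := tableRule_ne (h4 a b hab) i ε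
  undo s i hi ε := (h5 s).move_move hb k hi ε
  moves s i ε := by
    rw [tableRule_reduce]
    exact h6 s _ (by split_ifs <;> omega) ε

theorem isGood_oddTable (k : ℕ) : IsGood (5 + 2 * k) 4 oddTable := by
  apply isGood_of_table <;> decide +kernel

theorem isGood_evenTable (k : ℕ) : IsGood (8 + 2 * k) 6 evenTable := by
  apply isGood_of_table <;> decide +kernel

theorem exists_isGood {m : ℕ} (hm : 5 ≤ m) (h : Odd m ∨ 8 ≤ m) : ∃ c T, IsGood m c T := by
  rcases Nat.even_or_odd m with he | ho
  · have h8 : 8 ≤ m := h.resolve_left (Nat.not_odd_iff_even.mpr he)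
    obtain ⟨r, rfl⟩ := he
    exact ⟨6, evenTable, (show r + r = 8 + 2 * (r - 4) by omega) ▸ isGood_evenTable (r - 4)⟩
  · obtain ⟨r, rfl⟩ := ho
    exact ⟨4, oddTable, (show 2 * r + 1 = 5 + 2 * (r - 2) by omega) ▸ isGood_oddTable (r - 2)⟩

end Strip

/-! ### Maps that are a single cycle -/

theorem IsOneCycle.bijective {V : Type*} [Finite V] {f : V → V} (hf : IsOneCycle f) :
    Function.Bijective f := by
  have : Function.Surjective f := by
    intro y
    obtain ⟨t, ht⟩ := hf (f y) y
    refine ⟨f^[t] y, ?_⟩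
    rw [← Function.iterate_succ_apply' f t y, Function.iterate_succ_apply]
    exact ht
  exact ⟨Finite.injective_iff_surjective.mpr this, this⟩

theorem IsOneCycle.of_base {V : Type*} {f : V → V} (x₀ : V) (h₁ : ∀ x, Reaches f x₀ x)
    (h₂ : ∀ x, Reaches f x x₀) : IsOneCycle f := fun x y => (h₂ x).trans (h₁ y)

/-- An injective map of a finite set under which all points reach one point is a cycle. -/
theorem IsOneCycle.of_injective {V : Type*} [Finite V] {f : V → V} (hf : Function.Injective f)
    (x₀ : V) (h : ∀ x, Reaches f x x₀) : IsOneCycle f := by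
  refine IsOneCycle.of_base x₀ (fun x => ?_) h
  obtain ⟨t, ht⟩ := h x
  obtain ⟨n, hn, hp⟩ := Function.Injective.mem_periodicPts hf x
  -- Since `n` is a period of `x`, going on from `f^[t] x` for `n * t - t` steps returns to `x`.
  refine ⟨n * t - t, ?_⟩
  rw [← ht, ← Function.iterate_add_apply, Nat.sub_add_cancel (Nat.le_mul_of_pos_left t hn)]
  exact (hp.mul_const t).eq

theorem IsOneCycle.ne_self {V : Type*} [Nontrivial V] {f : V → V} (hf : IsOneCycle f) (x : V) :
    f x ≠ x := by
  intro h
  obtain ⟨y, hy⟩ := exists_ne x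
  obtain ⟨t, rfl⟩ := hf x y
  exact hy (Function.iterate_fixed h t)

theorem IsOneCycle.bijective_iterate {V : Type*} [Finite V] {f : V → V} (hf : IsOneCycle f)
    (v₀ : V) :
    Function.Bijective (fun i : Fin (Function.minimalPeriod f v₀) => f^[i] v₀) := by
  have hper : v₀ ∈ Function.periodicPts f :=
    Function.Injective.mem_periodicPts hf.bijective.1 v₀
  constructor
  · intro i j hij
    exact Fin.ext (Function.iterate_injOn_Iio_minimalPeriod i.2 j.2 hij)
  · intro v
    obtain ⟨t, ht⟩ := hf v₀ v
    exact ⟨⟨t % Function.minimalPeriod f v₀,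
      Nat.mod_lt _ (Function.minimalPeriod_pos_of_mem_periodicPts hper)⟩,
      Function.iterate_mod_minimalPeriod_eq.trans ht⟩

theorem IsOneCycle.minimalPeriod_eq {V : Type*} [Fintype V] {f : V → V} (hf : IsOneCycle f)
    (v₀ : V) : Function.minimalPeriod f v₀ = Fintype.card V := by
  rw [← Fintype.card_congr (Equiv.ofBijective _ (hf.bijective_iterate v₀)), Fintype.card_fin]

/-- The points of a cycle can be numbered along the cycle. -/
theorem IsOneCycle.exists_index {V : Type*} [Fintype V] [Nonempty V] {f : V → V}
    (hf : IsOneCycle f) : ∃ ι : V → ℕ, Function.Injective ι ∧ (∀ v, ι v < Fintype.card V) ∧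
      ∀ v, ι (f v) = if ι v + 1 = Fintype.card V then 0 else ι v + 1 := by
  obtain ⟨v₀⟩ := ‹Nonempty V›
  rw [← hf.minimalPeriod_eq v₀]
  set N := Function.minimalPeriod f v₀ with hN
  let e : Fin N ≃ V := Equiv.ofBijective _ (hf.bijective_iterate v₀)
  have he : ∀ v, f^[(e.symm v : ℕ)] v₀ = v := fun v => e.apply_symm_apply v
  refine ⟨fun v => e.symm v, fun v w h => e.symm.injective (Fin.ext h),
    fun v => (e.symm v).2, fun v => ?_⟩
  have hlt : (if (e.symm v : ℕ) + 1 = N then 0 else (e.symm v : ℕ) + 1) < N := by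
    have := (e.symm v).2
    split_ifs <;> omega
  have key : e.symm (f v) = ⟨_, hlt⟩ := by
    rw [Equiv.symm_apply_eq]
    show f v = f^[_] v₀
    have hv : f v = f^[(e.symm v : ℕ) + 1] v₀ := by
      rw [Function.iterate_succ_apply' f, he]
    split_ifs with h
    · rw [hv]
      exact (congrArg (fun n => f^[n] v₀) h).trans Function.iterate_minimalPeriod
    · exact hv
  exact congrArg Fin.val key

/-! ### Lifting cycles to two sheets -/

/-- The move in `V × Bool` according to a rule, along the cycle `f` with inverse `f'` whose
points are numbered by `ι`. -/
def blowUp {V : Type*} (f f' : V → V) (ι : V → ℕ) (τ : Strip.Rule) (v : V × Bool) : V × Bool :=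
  (match (τ (ι v.1) v.2).1 with
    | none => v.1
    | some true => f v.1
    | some false => f' v.1, (τ (ι v.1) v.2).2)

section BlowUp

open Strip

variable {V : Type*} {f f' : V → V} {ι : V → ℕ}

theorem blowUp_index [Fintype V] (hι : ∀ v, ι v < Fintype.card V)
    (hf : ∀ v, ι (f v) = if ι v + 1 = Fintype.card V then 0 else ι v + 1)
    (hf' : ∀ v, f (f' v) = v) (τ : Rule) (v : V × Bool) :
    (ι (blowUp f f' ι τ v).1, (blowUp f f' ι τ v).2) = move (Fintype.card V) τ (ι v.1, v.2) := by
  have h' : ∀ v, ι (f' v) = if ι v = 0 then Fintype.card V - 1 else ι v - 1 := fun v => by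
    have h1 := hf (f' v)
    rw [hf'] at h1
    have h2 := hι (f' v)
    split_ifs at * <;> omega
  simp only [blowUp, move, Prod.mk.injEq, and_true]
  rcases (τ (ι v.1) v.2).1 with _ | _ | _
  · rfl
  · exact h' _
  · exact hf _

theorem isOneCycle_blowUp [Fintype V] (hinj : Function.Injective ι) (hι : ∀ v, ι v < Fintype.card V)
    (hf : ∀ v, ι (f v) = if ι v + 1 = Fintype.card V then 0 else ι v + 1)
    (hf' : ∀ v, f (f' v) = v) {τ : Rule} (hτ : IsCyclicOn (Fintype.card V) τ) :
    IsOneCycle (blowUp f f' ι τ) := by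
  have hsemi : Function.Semiconj (fun v : V × Bool => (ι v.1, v.2)) (blowUp f f' ι τ)
      (move (Fintype.card V) τ) := blowUp_index hι hf hf' τ
  intro x y
  obtain ⟨t, ht⟩ := (hτ _ (hι x.1) x.2).2.trans (hτ _ (hι y.1) y.2).1
  refine ⟨t, ?_⟩
  have := hsemi.iterate_right t x
  simp only [ht, Prod.mk.injEq] at this
  exact Prod.ext (hinj this.1) this.2

theorem blowUp_blowUp [Fintype V] (hinj : Function.Injective ι) (hι : ∀ v, ι v < Fintype.card V)
    (hf : ∀ v, ι (f v) = if ι v + 1 = Fintype.card V then 0 else ι v + 1)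
    (hf' : ∀ v, f (f' v) = v) {σ τ : Rule}
    (h : ∀ i < Fintype.card V, ∀ ε, move (Fintype.card V) σ (move (Fintype.card V) τ (i, ε)) =
      (i, ε)) (v : V × Bool) : blowUp f f' ι σ (blowUp f f' ι τ v) = v := by
  have := blowUp_index hι hf hf' σ (blowUp f f' ι τ v)
  rw [blowUp_index hι hf hf' τ v, h _ (hι _)] at this
  simp only [Prod.mk.injEq] at this
  exact Prod.ext (hinj this.1) this.2

/-- The vertices `v`, `f v` and `f' v` are distinct, so a move can be read off from its end. Rules
which differ in every cell therefore give arc-disjoint cycles. -/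
theorem rule_eq_of_blowUp_eq (h₁ : ∀ v, f v ≠ v) (h₂ : ∀ v, f' v ≠ v) (h₃ : ∀ v, f v ≠ f' v)
    {σ τ : Rule} {v : V × Bool} (h : blowUp f f' ι σ v = blowUp f f' ι τ v) :
    σ (ι v.1) v.2 = τ (ι v.1) v.2 := by
  simp only [blowUp, Prod.mk.injEq] at h
  refine Prod.ext ?_ h.2
  replace h := h.1
  revert h
  rcases (σ (ι v.1) v.2).1 with _ | _ | _ <;> rcases (τ (ι v.1) v.2).1 with _ | _ | _ <;>
    simp [h₁, h₂, h₃, (h₁ _).symm, (h₂ _).symm, (h₃ _).symm]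

end BlowUp

/-- A two-sheeted cover of a cycle, with the sheets exchanged an odd number of times along the
cycle. -/
theorem isOneCycle_cover {V : Type*} [Fintype V] [DecidableEq V] {f : V → V} (hf : IsOneCycle f)
    (hV : Even (Fintype.card V)) (x₀ : V) (s : Bool) :
    IsOneCycle (fun v : V × Bool => (f v.1, xor (xor v.2 s) (decide (v.1 = x₀)))) := by
  set g := fun v : V × Bool => (f v.1, xor (xor v.2 s) (decide (v.1 = x₀))) with hg
  have hfst : ∀ t v, (g^[t] v).1 = f^[t] v.1 := fun t v =>
    (Function.Semiconj.iterate_right (f := Prod.fst) (ga := g) (gb := f) (fun _ => rfl) t) v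
  -- One turn applies the exchange `s` an even number of times, namely `Fintype.card V`, and the
  -- twist at `x₀` once, so it ends on the other sheet.
  have hturn : ∀ ε, Reaches g (x₀, ε) (x₀, !ε) := by
    intro ε
    have hwalk : ∀ t < Fintype.card V, g^[t + 1] (x₀, ε)
        = (f^[t + 1] x₀, xor (xor ε true) (decide (Odd (t + 1)) && s)) := by
      intro t
      induction t with
      | zero => intro _; cases ε <;> cases s <;> simp [hg]
      | succ t ih =>
        intro ht
        have hne : f^[t + 1] x₀ ≠ x₀ := fun h =>
          Function.not_isPeriodicPt_of_pos_of_lt_minimalPeriod (Nat.succ_ne_zero t)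
            (by rw [hf.minimalPeriod_eq]; exact ht) h
        rw [Function.iterate_succ_apply', ih (by omega), Function.iterate_succ_apply' f (t + 1)]
        refine Prod.ext rfl ?_
        simp only [hg, hne, decide_false, Bool.xor_false]
        by_cases ho : Odd (t + 1) <;> cases ε <;> cases s <;>
          simp [ho, Nat.odd_add_one (n := t + 1)]
    have hpos : 0 < Fintype.card V := Fintype.card_pos_iff.mpr ⟨x₀⟩
    refine ⟨Fintype.card V - 1 + 1, ?_⟩
    rw [hwalk _ (by omega), Nat.sub_add_cancel hpos, ← hf.minimalPeriod_eq x₀,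
      Function.iterate_minimalPeriod, hf.minimalPeriod_eq x₀]
    simp [Nat.not_odd_iff_even.mpr hV]
  refine IsOneCycle.of_injective ?_ (x₀, false) fun v => ?_
  · rintro ⟨x, ε⟩ ⟨y, δ⟩ h
    simp only [hg, Prod.mk.injEq] at h
    obtain rfl := hf.bijective.1 h.1
    simpa using h.2
  · obtain ⟨t, ht⟩ := hf v.1 x₀
    have h1 : Reaches g v (x₀, (g^[t] v).2) := ⟨t, Prod.ext ((hfst t v).trans ht) rfl⟩
    rcases h : (g^[t] v).2 with _ | _
    · rwa [h] at h1
    · rw [h] at h1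
      exact h1.trans (hturn true)

/-! ### Doubling a decomposition with paired cycles -/

/-- Directed Hamiltonian cycles in the complete digraph on `V`, pairwise arc-disjoint, indexed by
`E` and by `P × Bool`, so that the two cycles `(p, true)` and `(p, false)` are inverse. -/
def PairedCycles (V E P : Type*) : Prop :=
  ∃ F : E ⊕ P × Bool → V → V, (∀ j, IsOneCycle (F j)) ∧ (∀ i j x, F i x = F j x → i = j) ∧
    ∀ p x, F (Sum.inr (p, false)) (F (Sum.inr (p, true)) x) = x

/-- The pair `none` is the one used up with the arcs inside the fibres. The count fits: if e + 2(p +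
1) = m - 1, then 2e + 5 + 4p = 2m - 1. For odd m unpaired cycles are excluded, since their covers
need an even number of exchanges `s`. -/
theorem PairedCycles.double {V E P : Type*} [Fintype V] (h : PairedCycles V E (Option P))
    (hV : 5 ≤ Fintype.card V)
    (hE : IsEmpty E ∧ Odd (Fintype.card V) ∨ Even (Fintype.card V) ∧ 8 ≤ Fintype.card V) :
    PairedCycles (V × Bool) (E × Bool ⊕ Fin 5) (P × Bool) := by
  classical
  obtain ⟨F, hcyc, hdis, hinv⟩ := h
  have : Nontrivial V := Fintype.one_lt_card_iff_nontrivial.mp (by omega)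
  obtain ⟨c, T, hT⟩ := Strip.exists_isGood hV (hE.imp And.right And.right)
  let f : Option P → V → V := fun p => F (Sum.inr (p, true))
  let f' : Option P → V → V := fun p => F (Sum.inr (p, false))
  have hf'f : ∀ p v, f' p (f p v) = v := hinv
  have hff' : ∀ p v, f p (f' p v) = v := fun p v => by
    obtain ⟨w, rfl⟩ := (hcyc (Sum.inr (p, true))).bijective.2 v
    exact congrArg _ (hinv p w)
  have h₁ : ∀ p v, f p v ≠ v := fun p v => (hcyc _).ne_self v
  have h₂ : ∀ p v, f' p v ≠ v := fun p v => (hcyc _).ne_self v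
  have h₃ : ∀ p v, f p v ≠ f' p v := fun p v hv => by
    simpa using hdis _ _ _ hv
  choose ι hinj hι hιf using fun p => (hcyc (Sum.inr (p, true))).exists_index
  obtain ⟨x₀⟩ : Nonempty V := inferInstance
  let B : Option P → ℕ → V × Bool → V × Bool := fun p j =>
    blowUp (f p) (f' p) (ι p) (Strip.tableRule c (T.getD j []))
  let G : (E × Bool ⊕ Fin 5) ⊕ (P × Bool) × Bool → V × Bool → V × Bool := fun j =>
    match j with
    | Sum.inl (Sum.inl (e, s)) => fun v =>
      (F (Sum.inl e) v.1, xor (xor v.2 s) (decide (v.1 = x₀)))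
    | Sum.inl (Sum.inr a) => B none a
    | Sum.inr ((p, s), b) => B (some p) (Strip.fourIndex (s, b))
  -- Cycles lifted from different sources are separated by their projections to `V`. Only the rules
  -- over `none` may stay in a fibre; the four rules never do, by `moves`.
  have hB : ∀ p j x, (B p j x).1 = x.1 ∨ (B p j x).1 = f p x.1 ∨ (B p j x).1 = f' p x.1 := by
    intro p j x
    simp only [B, blowUp]
    rcases (Strip.tableRule c (T.getD j []) (ι p x.1) x.2).1 with _ | _ | _ <;> simp
  have hBs : ∀ p s x, (B p (Strip.fourIndex s) x).1 = f p x.1 ∨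
      (B p (Strip.fourIndex s) x).1 = f' p x.1 := by
    intro p s x
    have := hT.moves s (ι p x.1) x.2
    revert this
    simp only [B, blowUp]
    rcases (Strip.tableRule c (T.getD (Strip.fourIndex s) []) (ι p x.1) x.2).1 with _ | _ | _ <;>
      simp
  have hne : ∀ e p v, F (Sum.inl e) v ≠ f p v ∧ F (Sum.inl e) v ≠ f' p v ∧
      F (Sum.inl e) v ≠ v := fun e p v =>
    ⟨fun hv => by simpa using hdis _ _ _ hv, fun hv => by simpa using hdis _ _ _ hv,
      (hcyc _).ne_self v⟩
  have hpq : ∀ p q v, p ≠ q → f p v ≠ f q v ∧ f p v ≠ f' q v ∧ f' p v ≠ f q v ∧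
      f' p v ≠ f' q v := fun p q v hp =>
    ⟨fun hv => hp (by simpa using hdis _ _ _ hv), fun hv => by simpa using hdis _ _ _ hv,
      fun hv => by simpa using hdis _ _ _ hv, fun hv => hp (by simpa using hdis _ _ _ hv)⟩
  have hEB : ∀ e s p j x, G (Sum.inl (Sum.inl (e, s))) x ≠ B p j x := by
    intro e s p j x hx
    have h1 := congrArg Prod.fst hx
    have := hne e p x.1
    rcases hB p j x with h | h | h <;> rw [h] at h1
    exacts [this.2.2 h1, this.1 h1, this.2.1 h1]
  have hNB : ∀ (a : Fin 5) p s x, B none a x ≠ B (some p) (Strip.fourIndex s) x := by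
    intro a p s x hx
    have h1 := congrArg Prod.fst hx
    have := hpq none (some p) x.1 (by simp)
    rcases hB none a x with h | h | h <;> rcases hBs (some p) s x with h' | h' <;>
      rw [h, h'] at h1
    exacts [h₁ _ _ h1.symm, h₂ _ _ h1.symm, this.1 h1, this.2.1 h1, this.2.2.1 h1, this.2.2.2 h1]
  have hBcyc : ∀ p, ∀ j < 9, IsOneCycle (B p j) := fun p j hj =>
    isOneCycle_blowUp (hinj p) (hι p) (hιf p) (hff' p) (hT.cyclic j hj)
  have hfour : ∀ s, Strip.fourIndex s < 9 := by decide
  refine ⟨G, ?_, ?_, ?_⟩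
  · rintro ((⟨e, s⟩ | a) | ⟨⟨p, s⟩, b⟩)
    · have he : Even (Fintype.card V) := hE.elim (fun h => (h.1.false e).elim) And.left
      exact isOneCycle_cover (hcyc _) he x₀ s
    · exact hBcyc none a (by omega)
    · exact hBcyc (some p) _ (hfour _)
  · rintro ((⟨e, s⟩ | a) | ⟨⟨p, s⟩, b⟩) ((⟨e', s'⟩ | a') | ⟨⟨p', s'⟩, b'⟩) x hx
    · simp only [G, Prod.mk.injEq] at hx
      have he := hdis _ _ _ hx.1
      simp only [Sum.inl.injEq] at he
      subst he
      have hs : s = s' := by simpa using hx.2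
      rw [hs]
    · exact absurd hx (hEB _ _ _ _ _)
    · exact absurd hx (hEB _ _ _ _ _)
    · exact absurd hx.symm (hEB _ _ _ _ _)
    · by_contra hne
      exact hT.five a a' (by rintro rfl; exact hne rfl) _ _
        (rule_eq_of_blowUp_eq (h₁ _) (h₂ _) (h₃ _) hx)
    · exact absurd hx (hNB _ _ _ _)
    · exact absurd hx.symm (hEB _ _ _ _ _)
    · exact absurd hx.symm (hNB _ _ _ _)
    · by_cases hp : p = p'
      · subst hp
        by_contra hne
        exact hT.four (s, b) (s', b')
          (by rintro h; simp only [Prod.mk.injEq] at h; exact hne (by rw [h.1, h.2])) _ _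
          (rule_eq_of_blowUp_eq (h₁ _) (h₂ _) (h₃ _) hx)
      · have := hpq (some p) (some p') x.1 (by simpa using hp)
        have h1 := congrArg Prod.fst hx
        rcases hBs (some p) (s, b) x with h | h <;> rcases hBs (some p') (s', b') x with h' | h' <;>
          simp only [G, h, h'] at h1
        exacts [(this.1 h1).elim, (this.2.1 h1).elim, (this.2.2.1 h1).elim,
          (this.2.2.2 h1).elim]
  · rintro ⟨p, s⟩ x
    exact blowUp_blowUp (hinj _) (hι _) (hιf _) (hff' _) (hT.undo s) x

theorem Reaches.conj {V W : Type*} {f : V → V} {x y : V} (e : V ≃ W) (h : Reaches f x y) :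
    Reaches (e ∘ f ∘ e.symm) (e x) (e y) :=
  Reaches.map e (fun _ => True) (fun _ _ => trivial) (fun x _ => ⟨1, by simp⟩) trivial h

theorem IsOneCycle.conj {V W : Type*} {f : V → V} (hf : IsOneCycle f) (e : V ≃ W) :
    IsOneCycle (e ∘ f ∘ e.symm) := fun x y => by
  simpa using (hf (e.symm x) (e.symm y)).conj e

theorem PairedCycles.congr {V V' E E' P P' : Type*} (h : PairedCycles V E P) (v : V ≃ V')
    (e : E ≃ E') (p : P ≃ P') : PairedCycles V' E' P' := by
  obtain ⟨F, hcyc, hdis, hinv⟩ := h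
  let k : E' ⊕ P' × Bool ≃ E ⊕ P × Bool :=
    (Equiv.sumCongr e (Equiv.prodCongr p (Equiv.refl Bool))).symm
  refine ⟨fun j => v ∘ F (k j) ∘ v.symm, fun j => (hcyc _).conj v, fun i j x hx => ?_,
    fun q x => ?_⟩
  · exact k.injective (hdis _ _ _ (v.injective hx))
  · have := hinv (p.symm q) (v.symm x)
    simp only [Function.comp_apply, Equiv.symm_apply_apply]
    exact (congrArg v this).trans (v.apply_symm_apply x)

/-! ### Walecki's decomposition for odd order -/

namespace Walecki

/-- The zigzag `0, 1, -1, 2, -2, …`. -/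
def zigzag (N t : ℕ) : ZMod N := if t % 2 = 0 then -((t / 2 : ℕ) : ZMod N) else ((t / 2 + 1 : ℕ))

variable {r : ℕ}

/-- The successor along the cycle `∞, 0, 1, -1, 2, …, r`. -/
def next (r : ℕ) : Option (ZMod (2 * r)) → Option (ZMod (2 * r))
  | none => some 0
  | some x => if x.val = r then none else
      if 1 ≤ x.val ∧ x.val < r then some (-x) else some (1 - x)

theorem exists_zigzag (hr : 0 < r) (x : ZMod (2 * r)) : ∃ t < 2 * r, zigzag (2 * r) t = x := by
  have : NeZero (2 * r) := ⟨by omega⟩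
  have hx : ((x.val : ℕ) : ZMod (2 * r)) = x := ZMod.natCast_zmod_val x
  have hlt : x.val < 2 * r := x.val_lt
  rcases Nat.eq_zero_or_pos x.val with h0 | hpos
  · refine ⟨0, by omega, ?_⟩
    rw [← hx, h0]; simp [zigzag]
  by_cases hle : x.val ≤ r
  · refine ⟨2 * x.val - 1, by omega, ?_⟩
    rw [zigzag, if_neg (by omega), show (2 * x.val - 1) / 2 + 1 = x.val by omega, hx]
  · refine ⟨2 * (2 * r - x.val), by omega, ?_⟩
    rw [zigzag, if_pos (by omega), Nat.mul_div_cancel_left _ (by norm_num),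
      Nat.cast_sub hlt.le, hx, ZMod.natCast_self, zero_sub, neg_neg]

theorem next_zigzag (hr : 0 < r) {t : ℕ} (ht : t + 1 < 2 * r) :
    next r (some (zigzag (2 * r) t)) = some (zigzag (2 * r) (t + 1)) := by
  have : NeZero (2 * r) := ⟨by omega⟩
  obtain ⟨a, rfl | rfl⟩ := Nat.even_or_odd' t
  · have hz : zigzag (2 * r) (2 * a) = -(a : ZMod (2 * r)) := by simp [zigzag]
    have hz' : zigzag (2 * r) (2 * a + 1) = (a : ZMod (2 * r)) + 1 := by
      rw [zigzag, if_neg (by omega), show (2 * a + 1) / 2 + 1 = a + 1 by omega]; push_cast; rfl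
    have hv : (zigzag (2 * r) (2 * a)).val = if a = 0 then 0 else 2 * r - a := by
      split_ifs with h
      · rw [hz, h]; simp
      · have : zigzag (2 * r) (2 * a) = ((2 * r - a : ℕ) : ZMod (2 * r)) := by
          rw [hz, Nat.cast_sub (by omega), ZMod.natCast_self, zero_sub]
        rw [this, ZMod.val_natCast_of_lt (by omega)]
    simp only [next]
    rw [if_neg (by rw [hv]; split_ifs <;> omega), if_neg (by rw [hv]; split_ifs <;> omega), hz, hz']
    congr 1; ring
  · have hz : zigzag (2 * r) (2 * a + 1) = ((a + 1 : ℕ) : ZMod (2 * r)) := by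
      rw [zigzag, if_neg (by omega), show (2 * a + 1) / 2 + 1 = a + 1 by omega]
    have hz' : zigzag (2 * r) (2 * a + 1 + 1) = -((a + 1 : ℕ) : ZMod (2 * r)) := by
      rw [zigzag, if_pos (by omega), show (2 * a + 1 + 1) / 2 = a + 1 by omega]
    have hv : (zigzag (2 * r) (2 * a + 1)).val = a + 1 := by
      rw [hz, ZMod.val_natCast_of_lt (by omega)]
    simp only [next]
    rw [if_neg (by omega), if_pos (by omega), hz, hz']

theorem zigzag_last (hr : 0 < r) : zigzag (2 * r) (2 * r - 1) = (r : ZMod (2 * r)) := by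
  rw [zigzag, if_neg (by omega), show (2 * r - 1) / 2 + 1 = r by omega]

theorem next_half (hr : 0 < r) : next r (some (r : ZMod (2 * r))) = none := by
  simp [next, ZMod.val_natCast_of_lt (show r < 2 * r by omega)]

theorem half_add_half : (r : ZMod (2 * r)) + r = 0 := by
  rw [← Nat.cast_add, ← two_mul, ZMod.natCast_self]

/-- Rotation by the half turn `r` reverses the zigzag. This is what makes the rotations by `i` and
`i + r` inverse cycles. -/
theorem zigzag_reverse {t : ℕ} (ht : t < 2 * r) :
    zigzag (2 * r) (2 * r - 1 - t) = zigzag (2 * r) t + r := by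
  obtain ⟨a, rfl | rfl⟩ := Nat.even_or_odd' t
  · rw [zigzag, if_neg (by omega), zigzag, if_pos (by omega),
      show (2 * r - 1 - 2 * a) / 2 + 1 = r - a by omega, Nat.cast_sub (by omega),
      Nat.mul_div_cancel_left _ (by norm_num)]
    ring
  · rw [zigzag, if_pos (by omega), zigzag, if_neg (by omega),
      show (2 * r - 1 - (2 * a + 1)) / 2 = r - (a + 1) by omega, Nat.cast_sub (by omega),
      show (2 * a + 1) / 2 + 1 = a + 1 by omega]
    linear_combination -(half_add_half (r := r))

theorem isOneCycle_next (hr : 0 < r) : IsOneCycle (next r) := by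
  have : NeZero (2 * r) := ⟨by omega⟩
  have hsurj : Function.Surjective (next r) := by
    rintro (_ | x)
    · exact ⟨_, next_half hr⟩
    · obtain ⟨t, ht, rfl⟩ := exists_zigzag hr x
      rcases t with _ | t
      · exact ⟨none, by simp [next, zigzag]⟩
      · exact ⟨_, next_zigzag hr ht⟩
  refine IsOneCycle.of_injective (Finite.injective_iff_surjective.mpr hsurj) none ?_
  have hz : ∀ s t, t + s + 1 = 2 * r → Reaches (next r) (some (zigzag (2 * r) t)) none := by
    intro s
    induction s with
    | zero =>
      intro t ht
      rw [show t = 2 * r - 1 by omega, zigzag_last hr]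
      exact ⟨1, next_half hr⟩
    | succ s ih =>
      intro t ht
      exact Reaches.trans ⟨1, next_zigzag hr (by omega)⟩ (ih (t + 1) (by omega))
  rintro (_ | x)
  · exact Reaches.refl _ _
  · obtain ⟨t, ht, rfl⟩ := exists_zigzag hr x
    exact hz (2 * r - 1 - t) t (by omega)

theorem zigzag_step (t : ℕ) : zigzag (2 * r) (t + 1) - zigzag (2 * r) t
    = if t % 2 = 0 then ((t + 1 : ℕ) : ZMod (2 * r)) else -((t + 1 : ℕ) : ZMod (2 * r)) := by
  obtain ⟨a, rfl | rfl⟩ := Nat.even_or_odd' t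
  · rw [if_pos (by omega), zigzag, if_neg (by omega), zigzag, if_pos (by omega),
      show (2 * a + 1) / 2 + 1 = a + 1 by omega, Nat.mul_div_cancel_left _ (by norm_num)]
    push_cast; ring
  · rw [if_neg (by omega), zigzag, if_pos (by omega), zigzag, if_neg (by omega),
      show (2 * a + 1) / 2 + 1 = a + 1 by omega, show (2 * a + 1 + 1) / 2 = a + 1 by omega]
    push_cast; ring

/-- The differences along the zigzag are 1, -2, 3, -4, …, and parity makes sense modulo 2r, so they
are distinct. Hence an arc between finite vertices determines its place in the zigzag, and so the
rotation containing it. -/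
theorem zigzag_step_injective {s t : ℕ} (hs : s + 1 < 2 * r) (ht : t + 1 < 2 * r)
    (h : zigzag (2 * r) (s + 1) - zigzag (2 * r) s = zigzag (2 * r) (t + 1) - zigzag (2 * r) t) :
    s = t := by
  have hmix : ∀ a b : ℕ, (a + b) % 2 = 1 →
      ((a : ℕ) : ZMod (2 * r)) ≠ -((b : ℕ) : ZMod (2 * r)) := by
    intro a b hab heq
    have h0 : ((a + b : ℕ) : ZMod (2 * r)) = 0 := by
      push_cast; rw [heq]; ring
    rw [ZMod.natCast_eq_zero_iff] at h0
    have := (Dvd.intro _ rfl : 2 ∣ 2 * r).trans h0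
    omega
  have hinj : ∀ a b : ℕ, a < 2 * r → b < 2 * r → ((a : ℕ) : ZMod (2 * r)) = b → a = b := by
    intro a b ha hb hab
    rw [← ZMod.val_natCast_of_lt ha, ← ZMod.val_natCast_of_lt hb, hab]
  rw [zigzag_step, zigzag_step] at h
  split_ifs at h with h1 h2 h2
  · have := hinj _ _ hs ht h; omega
  · exact absurd h (hmix _ _ (by omega))
  · exact absurd h.symm (hmix _ _ (by omega))
  · have := hinj _ _ hs ht (neg_injective h); omega

/-- The cycle `next`, rotated by `i`. -/
def rotated (r : ℕ) (i : ZMod (2 * r)) : Option (ZMod (2 * r)) → Option (ZMod (2 * r)) :=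
  Equiv.optionCongr (Equiv.addRight i) ∘ next r ∘ (Equiv.optionCongr (Equiv.addRight i)).symm

theorem rotated_none (i : ZMod (2 * r)) : rotated r i none = some i := by
  show some ((0 : ZMod (2 * r)) + i) = some i
  rw [zero_add]

theorem rotated_some (i x : ZMod (2 * r)) :
    rotated r i (some x) = (next r (some (x - i))).map (· + i) := by
  show Option.map (· + i) (next r (some ((Equiv.addRight i).symm x))) = _
  simp [sub_eq_add_neg]

theorem rotated_zigzag (hr : 0 < r) (i : ZMod (2 * r)) {t : ℕ} (ht : t + 1 < 2 * r) :
    rotated r i (some (zigzag (2 * r) t + i)) = some (zigzag (2 * r) (t + 1) + i) := by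
  rw [rotated_some, add_sub_cancel_right, next_zigzag hr ht]; rfl

theorem rotated_half (hr : 0 < r) (i : ZMod (2 * r)) : rotated r i (some (r + i)) = none := by
  rw [rotated_some, add_sub_cancel_right, next_half hr]; rfl

theorem exists_zigzag_add (hr : 0 < r) (i x : ZMod (2 * r)) :
    x = r + i ∨ ∃ t, t + 1 < 2 * r ∧ x = zigzag (2 * r) t + i := by
  obtain ⟨t, ht, h⟩ := exists_zigzag hr (x - i)
  by_cases hl : t + 1 < 2 * r
  · exact Or.inr ⟨t, hl, by rw [h]; ring⟩
  · rw [show t = 2 * r - 1 by omega, zigzag_last hr] at h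
    exact Or.inl (by rw [h]; ring)

theorem rotated_disjoint (hr : 0 < r) {i j : ZMod (2 * r)} {v : Option (ZMod (2 * r))}
    (h : rotated r i v = rotated r j v) : i = j := by
  rcases v with _ | x
  · simpa [rotated_none] using h
  rcases exists_zigzag_add hr i x with hi | ⟨s, hs, hi⟩ <;>
    rcases exists_zigzag_add hr j x with hj | ⟨t, ht, hj⟩
  · exact add_left_cancel (hi.symm.trans hj)
  · rw [hj, rotated_zigzag hr j ht, ← hj, hi, rotated_half hr] at h
    exact absurd h (by simp)
  · rw [hj, rotated_half hr, ← hj, hi, rotated_zigzag hr i hs] at h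
    exact absurd h (by simp)
  · have h1 := h
    rw [hj, rotated_zigzag hr j ht, ← hj, hi, rotated_zigzag hr i hs] at h1
    have h2 : zigzag (2 * r) (s + 1) + i = zigzag (2 * r) (t + 1) + j := by simpa using h1
    have hij : zigzag (2 * r) s + i = zigzag (2 * r) t + j := hi.symm.trans hj
    obtain rfl := zigzag_step_injective hs ht (by linear_combination h2 - hij)
    exact add_left_cancel hij

theorem rotated_rotated (hr : 0 < r) (i : ZMod (2 * r)) (v : Option (ZMod (2 * r))) :
    rotated r (i + r) (rotated r i v) = v := by
  have h2 := half_add_half (r := r)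
  rcases v with _ | x
  · rw [rotated_none]
    convert rotated_half hr (i + r) using 3
    linear_combination -h2
  rcases exists_zigzag_add hr i x with rfl | ⟨t, ht, rfl⟩
  · rw [rotated_half hr, rotated_none, add_comm]
  · have h1 := zigzag_reverse (r := r) (t := t + 1) (by omega)
    have h3 := zigzag_reverse (r := r) (t := t) (by omega)
    have h4 := rotated_zigzag hr (i + r) (t := 2 * r - 1 - (t + 1)) (by omega)
    rw [show 2 * r - 1 - (t + 1) + 1 = 2 * r - 1 - t by omega, h1, h3] at h4
    rw [rotated_zigzag hr i ht]
    convert h4 using 2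
    · congr 1; linear_combination -h2
    · linear_combination -h2

theorem pairedCycles (hr : 0 < r) : PairedCycles (Option (ZMod (2 * r))) Empty (Fin r) := by
  -- The rotations by `p` and `p + r`, for `p < r`, are the inverse pairs, and together they are all
  -- rotations.
  let k : Fin r × Bool → ZMod (2 * r) := fun p => ((p.1 : ℕ) : ZMod (2 * r)) + if p.2 then 0 else r
  have hk : ∀ p, k p = ((p.1 + if p.2 then 0 else r : ℕ) : ZMod (2 * r)) := fun p => by
    simp only [k]; push_cast; rfl
  have hkinj : Function.Injective k := by
    rintro ⟨p, b⟩ ⟨q, c⟩ h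
    have hlt : ∀ p : Fin r × Bool, (p.1 + if p.2 then 0 else r : ℕ) < 2 * r := fun p => by
      have := p.1.2
      split_ifs <;> omega
    rw [hk, hk] at h
    have := congrArg ZMod.val h
    rw [ZMod.val_natCast_of_lt (hlt _), ZMod.val_natCast_of_lt (hlt _)] at this
    have hp := p.2
    have hq := q.2
    rcases b with _ | _ <;> rcases c with _ | _ <;> simp at this ⊢ <;> omega
  refine ⟨fun j => Sum.elim (fun e => e.elim) (fun p => rotated r (k p)) j, ?_, ?_, ?_⟩
  · rintro (e | p)
    · exact e.elim
    · exact (isOneCycle_next hr).conj _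
  · rintro (e | p) (e' | q) x h
    · exact e.elim
    · exact e.elim
    · exact e'.elim
    exact congrArg _ (hkinj (rotated_disjoint hr h))
  · intro p x
    simpa [k] using rotated_rotated hr ((p : ℕ) : ZMod (2 * r)) x

end Walecki

/-! ### Small even orders, and the recursion for even order -/

/-- The permutations of `Fin n` given by the rows of a table. -/
def tableMap (n : ℕ) [NeZero n] (T : List (List ℕ)) (j : ℕ) (x : Fin n) : Fin n :=
  Fin.ofNat n ((T.getD j []).getD x 0)

theorem pairedCycles_of_table (n e p : ℕ) [NeZero n] (T : List (List ℕ))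
    (h1 : ∀ j < e + 2 * p, ∀ x, (∃ t < n, (tableMap n T j)^[t] 0 = x) ∧
      ∃ t < n, (tableMap n T j)^[t] x = 0)
    (h2 : ∀ i < e + 2 * p, ∀ j < i, ∀ x, tableMap n T i x ≠ tableMap n T j x)
    (h3 : ∀ q < p, ∀ x, tableMap n T (e + 2 * q + 1) (tableMap n T (e + 2 * q) x) = x) :
    PairedCycles (Fin n) (Fin e) (Fin p) := by
  let k : Fin e ⊕ Fin p × Bool → ℕ := Sum.elim (fun a => a)
    (fun q => e + 2 * q.1 + if q.2 then 0 else 1)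
  have hk : ∀ j, k j < e + 2 * p := by
    rintro (a | ⟨q, b⟩)
    · have := a.2; simp only [k, Sum.elim_inl]; omega
    · have := q.2; simp only [k, Sum.elim_inr]; split_ifs <;> omega
  have hkinj : Function.Injective k := by
    rintro (a | ⟨q, b⟩) (a' | ⟨q', b'⟩) h <;>
      simp only [k, Sum.elim_inl, Sum.elim_inr] at h
    · exact congrArg _ (Fin.ext h)
    · have := a.2; omega
    · have := a'.2; omega
    · rcases b with _ | _ <;> rcases b' with _ | _ <;>
        simp only [Bool.false_eq_true, if_true, if_false] at h
      · obtain rfl : q = q' := Fin.ext (by omega)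
        rfl
      · omega
      · omega
      · obtain rfl : q = q' := Fin.ext (by omega)
        rfl
  refine ⟨fun j => tableMap n T (k j), fun j => ?_, fun i j x h => ?_, fun q x => ?_⟩
  · exact IsOneCycle.of_base 0 (fun x => let ⟨t, _, ht⟩ := (h1 _ (hk j) x).1; ⟨t, ht⟩)
      (fun x => let ⟨t, _, ht⟩ := (h1 _ (hk j) x).2; ⟨t, ht⟩)
  · by_contra hij
    rcases lt_trichotomy (k i) (k j) with hlt | heq | hlt
    · exact h2 _ (hk j) _ hlt x h.symm
    · exact hij (hkinj heq)
    · exact h2 _ (hk i) _ hlt x h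
  · exact h3 q q.2 x

/-- The rows are the successor maps of seven cycles, the last two of which are inverse. -/
def eightTable : List (List ℕ) :=
  [[7, 2, 0, 4, 6, 3, 1, 5],
   [6, 0, 5, 7, 3, 1, 4, 2],
   [2, 5, 4, 0, 1, 7, 3, 6],
   [3, 6, 1, 5, 2, 4, 7, 0],
   [1, 4, 7, 6, 5, 2, 0, 3],
   [5, 7, 3, 1, 0, 6, 2, 4],
   [4, 3, 6, 2, 7, 0, 5, 1]]

/-- The rows are the successor maps of eleven cycles, the last six of which form
three inverse pairs. -/
def twelveTable : List (List ℕ) :=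
  [[3, 9, 7, 11, 8, 0, 1, 5, 2, 4, 6, 10],
   [2, 6, 1, 9, 7, 10, 4, 3, 5, 11, 0, 8],
   [1, 10, 8, 0, 11, 6, 7, 4, 3, 2, 5, 9],
   [5, 0, 9, 8, 6, 7, 10, 2, 11, 3, 1, 4],
   [10, 2, 0, 7, 9, 8, 5, 6, 4, 1, 11, 3],
   [11, 4, 3, 1, 0, 9, 8, 10, 7, 6, 2, 5],
   [4, 3, 10, 2, 1, 11, 9, 8, 6, 5, 7, 0],
   [7, 11, 5, 4, 2, 1, 0, 9, 10, 8, 3, 6],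
   [6, 5, 4, 10, 3, 2, 11, 0, 9, 7, 8, 1],
   [9, 8, 11, 6, 5, 3, 2, 1, 0, 10, 4, 7],
   [8, 7, 6, 5, 10, 4, 3, 11, 1, 0, 9, 2]]

/-- The rows are the successor maps of 15 cycles, the last ten of which form five inverse pairs. -/
def sixteenTable : List (List ℕ) :=
  [[7, 13, 0, 12, 11, 15, 10, 9, 6, 8, 3, 5, 4, 2, 1, 14],
   [1, 2, 9, 0, 12, 10, 13, 8, 14, 7, 6, 4, 5, 3, 15, 11],
   [3, 14, 13, 11, 10, 9, 8, 0, 1, 6, 5, 15, 2, 4, 7, 12],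
   [2, 8, 1, 10, 13, 12, 11, 14, 9, 5, 7, 3, 15, 6, 0, 4],
   [14, 0, 12, 13, 15, 11, 9, 10, 7, 2, 4, 6, 3, 1, 8, 5],
   [5, 4, 3, 1, 0, 13, 12, 11, 10, 14, 9, 8, 7, 15, 2, 6],
   [4, 3, 14, 2, 1, 0, 15, 12, 11, 10, 8, 7, 6, 5, 9, 13],
   [15, 6, 5, 4, 2, 1, 0, 13, 12, 11, 14, 10, 9, 8, 3, 7],
   [6, 5, 4, 14, 3, 2, 1, 15, 13, 12, 11, 9, 8, 7, 10, 0],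
   [9, 15, 7, 6, 5, 3, 2, 1, 0, 13, 12, 14, 11, 10, 4, 8],
   [8, 7, 6, 5, 14, 4, 3, 2, 15, 0, 13, 12, 10, 9, 11, 1],
   [11, 10, 15, 8, 7, 6, 4, 3, 2, 1, 0, 13, 14, 12, 5, 9],
   [10, 9, 8, 7, 6, 14, 5, 4, 3, 15, 1, 0, 13, 11, 12, 2],
   [13, 12, 11, 15, 9, 8, 7, 5, 4, 3, 2, 1, 0, 14, 6, 10],
   [12, 11, 10, 9, 8, 7, 14, 6, 5, 4, 15, 2, 1, 0, 13, 3]]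

theorem pairedCycles_eight : PairedCycles (Fin 8) (Fin 5) (Fin 1) := by
  apply pairedCycles_of_table 8 5 1 eightTable <;> decide +kernel

theorem pairedCycles_twelve : PairedCycles (Fin 12) (Fin 5) (Fin 3) := by
  apply pairedCycles_of_table 12 5 3 twelveTable <;> decide +kernel

theorem pairedCycles_sixteen : PairedCycles (Fin 16) (Fin 5) (Fin 5) := by
  apply pairedCycles_of_table 16 5 5 sixteenTable <;> decide +kernel

theorem pairedCycles_odd {r : ℕ} (hr : 0 < r) :
    PairedCycles (Fin (2 * r + 1)) (Fin 0) (Fin r) := by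
  have : NeZero (2 * r) := ⟨by omega⟩
  exact (Walecki.pairedCycles hr).congr
    (Fintype.equivFinOfCardEq (by rw [Fintype.card_option, ZMod.card]))
    (Fintype.equivFinOfCardEq (by simp)) (Equiv.refl _)

theorem PairedCycles.double_fin {m e p : ℕ} (h : PairedCycles (Fin m) (Fin e) (Fin (p + 1)))
    (hm : 5 ≤ m) (he : e = 0 ∧ Odd m ∨ Even m ∧ 8 ≤ m) :
    PairedCycles (Fin (2 * m)) (Fin (2 * e + 5)) (Fin (2 * p)) := by
  have h1 : PairedCycles (Fin m) (Fin e) (Option (Fin p)) :=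
    h.congr (Equiv.refl _) (Equiv.refl _) (finSuccEquiv p)
  have h2 := h1.double (by simpa using hm) (by
    simp only [Fintype.card_fin]
    exact he.imp_left fun h => ⟨by rw [h.1]; infer_instance, h.2⟩)
  exact h2.congr (Fintype.equivFinOfCardEq (by simp [mul_comm]))
    (Fintype.equivFinOfCardEq (by simp [mul_comm]))
    (Fintype.equivFinOfCardEq (by simp [mul_comm]))

/-- Two pairs are demanded because doubling consumes one pair and doubles the rest: two or more
pairs stay two or more. Half of 12 is 6, an order that is not available, and the table of order 8
has only one pair, so 12 and 16 are given by tables. -/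
theorem exists_pairedCycles_even (n : ℕ) (hn : Even n) (h10 : 10 ≤ n) :
    ∃ e p, e + 2 * (p + 2) + 1 = n ∧ PairedCycles (Fin n) (Fin e) (Fin (p + 2)) := by
  induction n using Nat.strong_induction_on with
  | _ n ih =>
    by_cases h12 : n = 12
    · exact ⟨5, 1, by omega, h12 ▸ pairedCycles_twelve⟩
    by_cases h16 : n = 16
    · exact ⟨5, 3, by omega, h16 ▸ pairedCycles_sixteen⟩
    obtain ⟨m, rfl⟩ := hn
    rw [← two_mul]
    rcases Nat.even_or_odd m with he | ho
    · have h10 : 10 ≤ m := by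
        obtain ⟨q, rfl⟩ := he
        omega
      obtain ⟨e, p, hep, h⟩ := ih m (by omega) he h10
      exact ⟨2 * e + 5, 2 * p, by omega,
        PairedCycles.double_fin (p := p + 1) h (by omega) (Or.inr ⟨he, by omega⟩)⟩
    · obtain ⟨r, rfl⟩ := ho
      obtain ⟨p, rfl⟩ : ∃ p, r = p + 2 := ⟨r - 2, by omega⟩
      have h := pairedCycles_odd (r := p + 2) (by omega)
      exact ⟨5, 2 * p, by omega,
        PairedCycles.double_fin (p := p + 1) h (by omega) (Or.inl ⟨rfl, by use p + 2⟩)⟩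

/-! ### Hamiltonian decompositions of complete digraphs -/

/-- There are `q` directed Hamiltonian cycles in the complete digraph on `V` which are pairwise
arc-disjoint. -/
def DisjointCycles (V : Type*) (q : ℕ) : Prop :=
  ∃ F : Fin q → V → V, (∀ j, IsOneCycle (F j)) ∧ ∀ i j x, F i x = F j x → i = j

theorem PairedCycles.disjointCycles {V E P : Type*} [Fintype E] [Fintype P]
    (h : PairedCycles V E P) : DisjointCycles V (Fintype.card E + 2 * Fintype.card P) := by
  obtain ⟨F, hcyc, hdis, -⟩ := h
  let k : Fin (Fintype.card E + 2 * Fintype.card P) ≃ E ⊕ P × Bool :=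
    (Fintype.equivFinOfCardEq (by simp [mul_comm])).symm
  exact ⟨fun j => F (k j), fun j => hcyc _, fun i j x h => k.injective (hdis _ _ _ h)⟩

theorem DisjointCycles.congr {V W : Type*} {q : ℕ} (h : DisjointCycles V q) (e : V ≃ W) :
    DisjointCycles W q := by
  obtain ⟨F, hcyc, hdis⟩ := h
  exact ⟨fun j => e ∘ F j ∘ e.symm, fun j => (hcyc j).conj e,
    fun i j x hx => hdis _ _ _ (e.injective hx)⟩

/-- A complete digraph of odd order decomposes into directed Hamiltonian cycles. -/
theorem disjointCycles_odd {V : Type*} [Fintype V] {r : ℕ} (hr : 0 < r)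
    (hV : Fintype.card V = 2 * r + 1) : DisjointCycles V (2 * r) := by
  have := (pairedCycles_odd hr).disjointCycles.congr (Fintype.equivFinOfCardEq hV).symm
  simpa using this

/-- Tillson's theorem: a complete digraph of even order at least 8 decomposes into directed
Hamiltonian cycles. -/
theorem disjointCycles_even {V : Type*} [Fintype V] (hV : Even (Fintype.card V))
    (h8 : 8 ≤ Fintype.card V) : DisjointCycles V (Fintype.card V - 1) := by
  have key : DisjointCycles (Fin (Fintype.card V)) (Fintype.card V - 1) := by
    by_cases h : Fintype.card V = 8
    · rw [h]
      simpa using pairedCycles_eight.disjointCycles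
    · obtain ⟨e, p, hep, h⟩ := exists_pairedCycles_even _ hV (by
        obtain ⟨q, hq⟩ := hV
        omega)
      have := h.disjointCycles
      rwa [Fintype.card_fin, Fintype.card_fin,
        show e + 2 * (p + 2) = Fintype.card V - 1 by omega] at this
  exact key.congr (Fintype.equivFin V).symm

/-! ### Degree bounds and vanishing of the connectivities -/

namespace Digraph

variable {V : Type*} {D : Digraph V}

theorem exists_adj_of_reflTransGen {R : V → V → Prop} {x y : V} (h : Relation.ReflTransGen R x y)
    (hne : x ≠ y) : ∃ z, R x z := by
  rcases Relation.ReflTransGen.cases_head h with h | ⟨z, hz, -⟩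
  · exact absurd h hne
  · exact ⟨z, hz⟩

/-- The set of out-neighbours of a vertex. -/
noncomputable def outNeighbors [Fintype V] (D : Digraph V) (v : V) : Finset V :=
  open Classical in Finset.univ.filter (D.Adj v)

theorem mem_outNeighbors [Fintype V] {v w : V} : w ∈ D.outNeighbors v ↔ D.Adj v w := by
  simp [outNeighbors]

theorem card_outNeighbors_add_complement [Fintype V] (hD : D.Loopless) (v : V) :
    (D.outNeighbors v).card + (D.complement.outNeighbors v).card + 1 = Fintype.card V := by
  classical
  have h1 : Disjoint (D.outNeighbors v) (D.complement.outNeighbors v) :=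
    Finset.disjoint_filter.mpr fun w _ h h' => h'.2 h
  have h2 : D.outNeighbors v ∪ D.complement.outNeighbors v = Finset.univ.erase v := by
    ext w
    simp only [Finset.mem_union, mem_outNeighbors, complement, Finset.mem_erase, Finset.mem_univ,
      and_true]
    constructor
    · rintro (h | h)
      · rintro rfl; exact hD _ h
      · exact h.1.symm
    · intro h
      by_cases hw : D.Adj v w
      · exact Or.inl hw
      · exact Or.inr ⟨h.symm, hw⟩
  rw [← Finset.card_union_of_disjoint h1, h2,
    Finset.card_erase_add_one (Finset.mem_univ v), Finset.card_univ]

/-- A family of pairwise arc-disjoint strong subgraphs containing `S`. -/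
def IsPacking {ι : Type*} (S : Finset V) (H : ι → D.Subdigraph) : Prop :=
  (∀ i, (H i).IsStrong ∧ ∀ v ∈ S, v ∈ (H i).verts) ∧ ∀ i j, i ≠ j → (H i).ArcDisjoint (H j)

/-- Each member has an arc leaving `v` towards another vertex of `S`, and arc-disjointness makes the
heads of these arcs distinct. -/
theorem IsPacking.le_card_outNeighbors [Fintype V] {S : Finset V} (hS : 2 ≤ S.card) {p : ℕ}
    {H : Fin p → D.Subdigraph} (hH : IsPacking S H) {v : V} (hv : v ∈ S) :
    p ≤ (D.outNeighbors v).card := by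
  obtain ⟨u, hu, huv⟩ := Finset.exists_mem_ne (by omega : 1 < S.card) v
  have harc : ∀ i, ∃ w, (H i).Adj v w := fun i =>
    exists_adj_of_reflTransGen
      ((hH.1 i).1.2 v ((hH.1 i).2 v hv) u ((hH.1 i).2 u hu)) huv.symm
  choose w hw using harc
  have hinj : Function.Injective w := by
    intro i j hij
    by_contra hne
    exact hH.2 i j hne v (w i) ⟨hw i, hij ▸ hw j⟩
  have := Finset.card_le_card_of_injOn (s := Finset.univ) (t := D.outNeighbors v) w
    (fun i _ => by simpa [outNeighbors] using (H i).adj_sub (hw i)) hinj.injOn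
  simpa using this

theorem localStrongArcConnectivity_le [Fintype V] {S : Finset V} (hS : 2 ≤ S.card) {v : V}
    (hv : v ∈ S) : D.localStrongArcConnectivity S ≤ (D.outNeighbors v).card := by
  refine csSup_le ⟨0, fun i => i.elim0, fun i => i.elim0, fun i => i.elim0⟩ ?_
  rintro p ⟨H, hH⟩
  exact IsPacking.le_card_outNeighbors hS hH hv

theorem IsPacking.card_le [Fintype V] {S : Finset V} (hS : 2 ≤ S.card) {ι : Type*} [Fintype ι]
    {H : ι → D.Subdigraph} (hH : IsPacking S H) :
    Fintype.card ι ≤ D.localStrongArcConnectivity S := by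
  obtain ⟨v, hv⟩ : S.Nonempty := Finset.card_pos.mp (by omega)
  -- The degree bound shows that the supremum is over a bounded set; otherwise `sSup` would take its
  -- default value 0.
  refine le_csSup ⟨(D.outNeighbors v).card, ?_⟩ ?_
  · rintro p ⟨H, hH⟩
    exact IsPacking.le_card_outNeighbors hS hH hv
  · let e := (Fintype.equivFin ι).symm
    exact ⟨fun i => H (e i), fun i => hH.1 _, fun i j hij => hH.2 _ _ (e.injective.ne hij)⟩

theorem strongArcConnectivity_le [Fintype V] {k : ℕ} (hk : 2 ≤ k) (hkn : k ≤ Fintype.card V)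
    (v : V) : D.strongArcConnectivity k ≤ (D.outNeighbors v).card := by
  obtain ⟨S, hvS, hS⟩ := Finset.exists_superset_card_eq (s := {v})
    (by rw [Finset.card_singleton]; omega) hkn
  have h : D.strongArcConnectivity k ≤ D.localStrongArcConnectivity S :=
    Nat.sInf_le ⟨S, hS, rfl⟩
  exact h.trans
    (localStrongArcConnectivity_le (by omega) (hvS (Finset.mem_singleton_self v)))

theorem le_strongArcConnectivity [Fintype V] {k p : ℕ} (hkn : k ≤ Fintype.card V)
    (h : ∀ S : Finset V, S.card = k → p ≤ D.localStrongArcConnectivity S) :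
    p ≤ D.strongArcConnectivity k := by
  -- A set of size `k` exists, so the infimum is attained and is not the default value 0 of `sInf
  -- ∅`.
  obtain ⟨S, -, hS⟩ := Finset.exists_subset_card_eq (s := (Finset.univ : Finset V)) hkn
  obtain ⟨S, hS, hm⟩ := Nat.sInf_mem
    (s := {m : ℕ | ∃ S : Finset V, S.card = k ∧ D.localStrongArcConnectivity S = m})
    ⟨_, S, hS, rfl⟩
  unfold strongArcConnectivity
  rw [← hm]
  exact h S hS

theorem sum_strongArcConnectivity_lt [Fintype V] {k : ℕ} (hk : 2 ≤ k)
    (hkn : k ≤ Fintype.card V) (hD : D.Loopless) :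
    D.strongArcConnectivity k + D.complement.strongArcConnectivity k + 1 ≤ Fintype.card V := by
  obtain ⟨v⟩ : Nonempty V := Fintype.card_pos_iff.mp (by omega)
  have h1 := strongArcConnectivity_le (D := D) hk hkn v
  have h2 := strongArcConnectivity_le (D := D.complement) hk hkn v
  have h3 := card_outNeighbors_add_complement hD v
  omega

/-- A strong digraph is itself a packing of size one. Conversely, as `k ≥ 2`, any two vertices lie
in a common `S`, and a strong subgraph on it joins them. -/
theorem strongArcConnectivity_eq_zero_iff [Fintype V] {k : ℕ} (hk : 2 ≤ k)
    (hkn : k ≤ Fintype.card V) : D.strongArcConnectivity k = 0 ↔ ¬ D.IsStrong := by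
  classical
  constructor
  · intro h hs
    have : 1 ≤ D.strongArcConnectivity k := by
      refine le_strongArcConnectivity hkn fun S hS => ?_
      obtain ⟨v, -⟩ : S.Nonempty := Finset.card_pos.mp (by omega)
      let H : Unit → D.Subdigraph := fun _ =>
        { verts := Set.univ, Adj := D.Adj, adj_sub := fun h => h,
          fst_mem := fun _ => trivial, snd_mem := fun _ => trivial }
      have hH : IsPacking S H :=
        ⟨fun _ => ⟨⟨⟨v, trivial⟩, fun x _ y _ => hs x y⟩, fun _ _ => trivial⟩,
          fun i j hij => absurd rfl hij⟩
      simpa using hH.card_le (by omega)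
    omega
  · intro hs
    by_contra hne
    refine hs fun x y => ?_
    have : 1 < Fintype.card V := by omega
    obtain ⟨S, hxy, hS⟩ := Finset.exists_superset_card_eq (s := {x, y})
      (Finset.card_le_two.trans hk) hkn
    have hle : D.strongArcConnectivity k ≤ D.localStrongArcConnectivity S :=
      Nat.sInf_le ⟨S, hS, rfl⟩
    obtain ⟨v, hv⟩ : S.Nonempty := Finset.card_pos.mp (by omega)
    have hmem := Nat.sSup_mem (s := {p : ℕ | ∃ H : Fin p → D.Subdigraph, IsPacking S H})
      ⟨0, fun i => i.elim0, fun i => i.elim0, fun i => i.elim0⟩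
      ⟨(D.outNeighbors v).card, by
        rintro p ⟨H, hH⟩
        exact IsPacking.le_card_outNeighbors (by omega) hH hv⟩
    obtain ⟨H, hH⟩ := hmem
    have hpos : 0 < D.localStrongArcConnectivity S := by omega
    obtain ⟨hstrong, hverts⟩ := hH.1 ⟨0, hpos⟩
    exact Relation.ReflTransGen.mono (fun _ _ h => (H ⟨0, hpos⟩).adj_sub h) _ _
      (hstrong.2 x (hverts x (hxy (by simp))) y (hverts y (hxy (by simp))))

theorem arcConnectivity_eq_zero_iff [Fintype V] (hV : 2 ≤ Fintype.card V) :
    D.arcConnectivity = 0 ↔ ¬ D.IsStrong := by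
  classical
  unfold arcConnectivity
  rw [Nat.sInf_eq_zero]
  constructor
  · rintro (⟨X, -, hX, hs⟩ | hempty)
    · rw [Finset.card_eq_zero] at hX
      subst hX
      have : D.deleteArcs ∅ = D := by
        ext x y
        simp [deleteArcs]
      rwa [this] at hs
    · exfalso
      -- Deleting all arcs leaves a digraph that is not strong, so the infimum is not over the empty
      -- set.
      obtain ⟨x, y, hxy⟩ := Fintype.exists_pair_of_one_lt_card hV
      refine Set.eq_empty_iff_forall_notMem.mp hempty _
        ⟨Finset.univ.filter (fun a : V × V => D.Adj a.1 a.2), by simp, rfl, fun hs => ?_⟩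
      obtain ⟨z, hz⟩ := exists_adj_of_reflTransGen (hs x y) hxy
      exact hz.2 (by simpa using hz.1)
  · intro hs
    refine Or.inl ⟨∅, by simp, rfl, fun h => hs fun x y => ?_⟩
    exact Relation.ReflTransGen.mono (fun _ _ h => h.1) _ _ (h x y)

/-! ### Packings from Hamiltonian cycles, and extremal digraphs -/

/-- The directed cycle of `f` on the vertices in the range of `φ`. -/
def cycleSubdigraph {W : Type*} (D : Digraph V) (φ : W → V) (f : W → W)
    (h : ∀ w, D.Adj (φ w) (φ (f w))) : D.Subdigraph where
  verts := Set.range φ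
  Adj x y := ∃ w, φ w = x ∧ φ (f w) = y
  adj_sub := by rintro _ _ ⟨w, rfl, rfl⟩; exact h w
  fst_mem := by rintro _ _ ⟨w, rfl, rfl⟩; exact ⟨w, rfl⟩
  snd_mem := by rintro _ _ ⟨w, rfl, rfl⟩; exact ⟨f w, rfl⟩

theorem cycleSubdigraph_isStrong {W : Type*} [Nonempty W] {φ : W → V} {f : W → W}
    (h : ∀ w, D.Adj (φ w) (φ (f w))) (hf : IsOneCycle f) :
    (cycleSubdigraph D φ f h).IsStrong := by
  refine ⟨Set.range_nonempty φ, ?_⟩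
  rintro _ ⟨x, rfl⟩ _ ⟨y, rfl⟩
  obtain ⟨t, rfl⟩ := hf x y
  induction t with
  | zero => exact Relation.ReflTransGen.refl
  | succ t ih =>
    rw [Function.iterate_succ_apply']
    exact ih.tail ⟨_, rfl, rfl⟩

theorem cycleSubdigraph_arcDisjoint {W : Type*} {φ : W → V} (hφ : Function.Injective φ)
    {f g : W → W} (hf : ∀ w, D.Adj (φ w) (φ (f w))) (hg : ∀ w, D.Adj (φ w) (φ (g w)))
    (h : ∀ w, f w ≠ g w) :
    (cycleSubdigraph D φ f hf).ArcDisjoint (cycleSubdigraph D φ g hg) := by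
  rintro x y ⟨⟨w, rfl, rfl⟩, w', hw, hy⟩
  obtain rfl := hφ hw
  exact h _ (hφ hy).symm

/-- Pairwise arc-disjoint Hamiltonian cycles bound the connectivity from below. -/
theorem le_strongArcConnectivity_of_cycles [Fintype V] {k q : ℕ} (hk : 2 ≤ k)
    (hkn : k ≤ Fintype.card V) {F : Fin q → V → V} (hcyc : ∀ j, IsOneCycle (F j))
    (hdis : ∀ i j x, F i x = F j x → i = j) (hD : ∀ j x, D.Adj x (F j x)) :
    q ≤ D.strongArcConnectivity k := by
  have : Nonempty V := Fintype.card_pos_iff.mp (by omega)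
  refine le_strongArcConnectivity hkn fun S hS => ?_
  have hH : IsPacking S (fun j => cycleSubdigraph D id (F j) (hD j)) :=
    ⟨fun j => ⟨cycleSubdigraph_isStrong _ (hcyc j), fun v _ => ⟨v, rfl⟩⟩,
      fun i j hij => cycleSubdigraph_arcDisjoint Function.injective_id _ _
        fun w hw => hij (hdis i j w hw)⟩
  simpa using hH.card_le (by omega)

/-- The complete digraph without loops. -/
def completeLoopless (V : Type*) : Digraph V where
  Adj x y := x ≠ y

theorem le_strongArcConnectivity_of_disjointCycles [Fintype V] {k q : ℕ} (hk : 2 ≤ k)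
    (hkn : k ≤ Fintype.card V) (h : DisjointCycles V q) :
    q ≤ (completeLoopless V).strongArcConnectivity k := by
  obtain ⟨F, hcyc, hdis⟩ := h
  have : Nontrivial V := Fintype.one_lt_card_iff_nontrivial.mp (by omega)
  exact le_strongArcConnectivity_of_cycles hk hkn hcyc hdis
    fun j x => ((hcyc j).ne_self x).symm

/-- All arcs between a vertex `v` and the other vertices. -/
def starSubdigraph (v : V) : (completeLoopless V).Subdigraph where
  verts := Set.univ
  Adj x y := x ≠ y ∧ (x = v ∨ y = v)
  adj_sub h := h.1
  fst_mem _ := trivial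
  snd_mem _ := trivial

theorem starSubdigraph_isStrong (v : V) : (starSubdigraph v).IsStrong := by
  refine ⟨⟨v, trivial⟩, fun x _ y _ => ?_⟩
  have h1 : Relation.ReflTransGen (starSubdigraph v).Adj x v := by
    by_cases h : x = v
    · rw [h]
    · exact Relation.ReflTransGen.single ⟨h, Or.inr rfl⟩
  by_cases h : y = v
  · rw [h]; exact h1
  · exact h1.tail ⟨Ne.symm h, Or.inl rfl⟩

/-- For `S` avoiding a vertex `v`, the Hamiltonian cycles of the complete digraph on the other
vertices and the star at `v` are arc-disjoint. -/
theorem le_localStrongArcConnectivity_of_star [Fintype V] {S : Finset V} (hS : 2 ≤ S.card) {v : V}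
    (hv : v ∉ S) {q : ℕ} (h : DisjointCycles {x // x ≠ v} q) :
    q + 1 ≤ (completeLoopless V).localStrongArcConnectivity S := by
  obtain ⟨F, hcyc, hdis⟩ := h
  have hmem : ∀ x ∈ S, x ≠ v := fun x hx h => hv (h ▸ hx)
  obtain ⟨a, ha, b, hb, hab⟩ := Finset.one_lt_card.mp hS
  have : Nontrivial {x // x ≠ v} :=
    ⟨⟨a, hmem a ha⟩, ⟨b, hmem b hb⟩, fun h => hab (congrArg Subtype.val h)⟩
  have hadj : ∀ j (w : {x // x ≠ v}), (completeLoopless V).Adj (w : V) (F j w : V) :=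
    fun j w h => (hcyc j).ne_self w (Subtype.ext h.symm)
  let H : Option (Fin q) → (completeLoopless V).Subdigraph := fun i =>
    i.elim (starSubdigraph v) fun j => cycleSubdigraph _ Subtype.val (F j) (hadj j)
  have hstar : ∀ j x y, ¬ ((starSubdigraph v).Adj x y ∧ (H (some j)).Adj x y) := by
    rintro j _ _ ⟨⟨-, h⟩, w, rfl, rfl⟩
    exact h.elim w.2 (F j w).2
  have hH : IsPacking S H := by
    refine ⟨?_, ?_⟩
    · rintro (_ | j)
      · exact ⟨starSubdigraph_isStrong v, fun _ _ => trivial⟩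
      · exact ⟨cycleSubdigraph_isStrong (hadj j) (hcyc j), fun x hx => ⟨⟨x, hmem x hx⟩, rfl⟩⟩
    · rintro (_ | i) (_ | j) hij
      · exact absurd rfl hij
      · exact hstar j
      · exact fun x y h => hstar i x y h.symm
      · exact cycleSubdigraph_arcDisjoint Subtype.val_injective (hadj i) (hadj j)
          fun w hw => hij (congrArg _ (hdis i j w hw))
  simpa using hH.card_le hS

theorem le_strongArcConnectivity_completeLoopless [Fintype V] {k : ℕ} (hk : 2 ≤ k)
    (hkn : k ≤ Fintype.card V)
    (hex : ¬ (k = Fintype.card V ∧ (Fintype.card V = 4 ∨ Fintype.card V = 6))) :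
    Fintype.card V - 1 ≤ (completeLoopless V).strongArcConnectivity k := by
  classical
  rcases Nat.even_or_odd' (Fintype.card V) with ⟨r, hr | hr⟩
  · by_cases hkV : k = Fintype.card V
    · by_cases h2 : Fintype.card V = 2
      · have hs : (completeLoopless V).IsStrong := fun x y => by
          by_cases h : x = y
          · rw [h]
          · exact Relation.ReflTransGen.single h
        have := mt (strongArcConnectivity_eq_zero_iff hk hkn).mp (not_not.mpr hs)
        omega
      · exact le_strongArcConnectivity_of_disjointCycles hk hkn
          (disjointCycles_even ⟨r, by omega⟩ (by omega))
    · refine le_strongArcConnectivity hkn fun S hS => ?_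
      obtain ⟨v, hv⟩ : ∃ v, v ∉ S := by
        by_contra! h
        have := Finset.card_eq_iff_eq_univ S |>.mpr (Finset.eq_univ_iff_forall.mpr h)
        omega
      have hcard : Fintype.card {x // x ≠ v} = 2 * (r - 1) + 1 := by
        rw [Fintype.card_subtype_compl, Fintype.card_subtype_eq]
        omega
      have := le_localStrongArcConnectivity_of_star (by omega) hv
        (disjointCycles_odd (by omega) hcard)
      omega
  · have := le_strongArcConnectivity_of_disjointCycles hk hkn
      (disjointCycles_odd (by omega) hr)
    omega

/-- The digraph of the first `r` of `2 r` arc-disjoint Hamiltonian cycles. -/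
theorem exists_half [Fintype V] {k r : ℕ} (hk : 2 ≤ k) (hkn : k ≤ Fintype.card V)
    (hV : Fintype.card V = 2 * r + 1) : ∃ D : Digraph V, D.Loopless ∧
      D.strongArcConnectivity k = r ∧ D.complement.strongArcConnectivity k = r := by
  have : Nontrivial V := Fintype.one_lt_card_iff_nontrivial.mp (by omega)
  obtain ⟨F, hcyc, hdis⟩ := disjointCycles_odd (by omega) hV
  let D : Digraph V := ⟨fun x y => ∃ j : Fin (2 * r), (j : ℕ) < r ∧ F j x = y⟩
  have hD : D.Loopless := by
    rintro x ⟨j, -, h⟩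
    exact (hcyc j).ne_self x h
  have h1 : r ≤ D.strongArcConnectivity k :=
    le_strongArcConnectivity_of_cycles hk hkn (F := fun j : Fin r => F ⟨j, by omega⟩)
      (fun j => hcyc _) (fun i j x h => by simpa [Fin.ext_iff] using hdis _ _ x h)
      (fun j x => ⟨⟨j, by omega⟩, j.2, rfl⟩)
  have h2 : r ≤ D.complement.strongArcConnectivity k :=
    le_strongArcConnectivity_of_cycles hk hkn (F := fun j : Fin r => F ⟨r + j, by omega⟩)
      (fun j => hcyc _) (fun i j x h => by simpa [Fin.ext_iff] using hdis _ _ x h)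
      (fun j x => ⟨((hcyc _).ne_self x).symm, by
        rintro ⟨i, hi, h⟩
        have := congrArg Fin.val (hdis _ _ x h)
        simp only at this
        omega⟩)
  have h3 := sum_strongArcConnectivity_lt hk hkn hD
  -- Both values are at least `r` and their sum is at most `2 * r`, so both equal `r`.
  exact ⟨D, hD, by omega, by omega⟩

/-- A transitive tournament and its complement are not strong. -/
theorem exists_not_isStrong [Fintype V] (hV : 2 ≤ Fintype.card V) :
    ∃ D : Digraph V, D.Loopless ∧ ¬ D.IsStrong ∧ ¬ D.complement.IsStrong := by
  let e := Fintype.equivFin V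
  obtain ⟨x, y, hxy⟩ := Fintype.exists_pair_of_one_lt_card hV
  have hmono : ∀ {R : V → V → Prop} (f : V → ℕ), (∀ a b, R a b → f a ≤ f b) →
      ∀ {a b}, Relation.ReflTransGen R a b → f a ≤ f b := by
    intro R f hR a b h
    induction h with
    | refl => exact le_rfl
    | tail _ h ih => exact ih.trans (hR _ _ h)
  have hne : (e x : ℕ) ≠ e y := fun h => hxy (e.injective (Fin.ext h))
  refine ⟨⟨fun a b => (e a : ℕ) < e b⟩, fun a => lt_irrefl _, fun h => ?_, fun h => ?_⟩
  · have h1 := hmono (fun a => (e a : ℕ)) (fun a b h => le_of_lt h) (h x y)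
    have h2 := hmono (fun a => (e a : ℕ)) (fun a b h => le_of_lt h) (h y x)
    omega
  · have hR : ∀ a b, (complement ⟨fun a b => (e a : ℕ) < e b⟩ : Digraph V).Adj a b →
        Fintype.card V - (e a : ℕ) ≤ Fintype.card V - e b := fun a b h => by
      have := h.2
      simp only [not_lt] at this
      omega
    have h1 := hmono (fun a => Fintype.card V - (e a : ℕ)) hR (h x y)
    have h2 := hmono (fun a => Fintype.card V - (e a : ℕ)) hR (h y x)
    have := (e x).2
    have := (e y).2
    omega

end Digraph

/-! ### The bounds and their sharpness -/

open Digraph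

theorem theorem4 {V : Type*} [Fintype V] (n k : ℕ) (hn : Fintype.card V = n)
    (hk : 2 ≤ k) (hkn : k ≤ n) :
    -- the bounds for the sum and the product, with the cases of equality in the lower bounds
    (∀ D : Digraph V, D.Loopless →
      ((0 : ℝ) ≤ (D.strongArcConnectivity k : ℝ) + (D.complement.strongArcConnectivity k : ℝ) ∧
        (D.strongArcConnectivity k : ℝ) + (D.complement.strongArcConnectivity k : ℝ)
          ≤ (n : ℝ) - 1 ∧
        ((D.strongArcConnectivity k : ℝ) + (D.complement.strongArcConnectivity k : ℝ) = 0 ↔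
          D.arcConnectivity = 0 ∧ D.complement.arcConnectivity = 0)) ∧
      ((0 : ℝ) ≤ (D.strongArcConnectivity k : ℝ) * (D.complement.strongArcConnectivity k : ℝ) ∧
        (D.strongArcConnectivity k : ℝ) * (D.complement.strongArcConnectivity k : ℝ)
          ≤ (((n : ℝ) - 1) / 2) ^ 2 ∧
        ((D.strongArcConnectivity k : ℝ) * (D.complement.strongArcConnectivity k : ℝ) = 0 ↔
          D.arcConnectivity = 0 ∨ D.complement.arcConnectivity = 0))) ∧
    -- sharpness of the lower bound for the sum
    (∃ D : Digraph V, D.Loopless ∧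
      (D.strongArcConnectivity k : ℝ) + (D.complement.strongArcConnectivity k : ℝ) = 0) ∧
    -- sharpness of the upper bound for the sum
    (¬ (k = n ∧ (n = 4 ∨ n = 6)) → ∃ D : Digraph V, D.Loopless ∧
      (D.strongArcConnectivity k : ℝ) + (D.complement.strongArcConnectivity k : ℝ)
        = (n : ℝ) - 1) ∧
    -- sharpness of the lower bound for the product
    (∃ D : Digraph V, D.Loopless ∧
      (D.strongArcConnectivity k : ℝ) * (D.complement.strongArcConnectivity k : ℝ) = 0) ∧
    -- sharpness of the upper bound for the product
    (Odd n → ∃ D : Digraph V, D.Loopless ∧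
      (D.strongArcConnectivity k : ℝ) * (D.complement.strongArcConnectivity k : ℝ)
        = (((n : ℝ) - 1) / 2) ^ 2) := by
  subst hn
  have hV : 2 ≤ Fintype.card V := hk.trans hkn
  have hzero : ∀ D : Digraph V, D.strongArcConnectivity k = 0 ↔ D.arcConnectivity = 0 :=
    fun D => (strongArcConnectivity_eq_zero_iff hk hkn).trans
      (arcConnectivity_eq_zero_iff hV).symm
  have hsum : ∀ D : Digraph V, D.Loopless →
      (D.strongArcConnectivity k : ℝ) + (D.complement.strongArcConnectivity k : ℝ)
        ≤ (Fintype.card V : ℝ) - 1 := fun D hD => by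
    have := sum_strongArcConnectivity_lt hk hkn hD
    rw [le_sub_iff_add_le]
    exact_mod_cast this
  refine ⟨fun D hD => ⟨⟨by positivity, hsum D hD, ?_⟩, by positivity, ?_, ?_⟩, ?_, ?_, ?_, ?_⟩
  · rw [← hzero, ← hzero]
    norm_cast
    exact Nat.add_eq_zero_iff
  · have h := hsum D hD
    have h0 : (0 : ℝ) ≤ (D.strongArcConnectivity k : ℝ) + D.complement.strongArcConnectivity k := by
      positivity
    -- This is 4ab = (a + b)² - (a - b)² ≤ (n - 1)².
    nlinarith [sq_nonneg ((D.strongArcConnectivity k : ℝ) - D.complement.strongArcConnectivity k)]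
  · rw [← hzero, ← hzero]
    norm_cast
    exact Nat.mul_eq_zero
  · obtain ⟨D, hD, h1, h2⟩ := exists_not_isStrong hV
    refine ⟨D, hD, ?_⟩
    rw [(strongArcConnectivity_eq_zero_iff hk hkn).mpr h1,
      (strongArcConnectivity_eq_zero_iff hk hkn).mpr h2]
    simp
  · intro hex
    have hD : (completeLoopless V).Loopless := fun x h => h rfl
    refine ⟨completeLoopless V, hD, le_antisymm (hsum _ hD) ?_⟩
    have h := le_strongArcConnectivity_completeLoopless hk hkn hex
    have h' : (Fintype.card V : ℝ) ≤ (completeLoopless V).strongArcConnectivity k + 1 := by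
      exact_mod_cast (by omega : Fintype.card V ≤ (completeLoopless V).strongArcConnectivity k + 1)
    have h0 : (0 : ℝ) ≤ (completeLoopless V).complement.strongArcConnectivity k := by positivity
    linarith
  · obtain ⟨D, hD, h1, -⟩ := exists_not_isStrong hV
    refine ⟨D, hD, ?_⟩
    rw [(strongArcConnectivity_eq_zero_iff hk hkn).mpr h1]
    simp
  · rintro ⟨r, hr⟩
    obtain ⟨D, hD, h1, h2⟩ := exists_half hk hkn hr
    refine ⟨D, hD, ?_⟩
    rw [h1, h2, hr]
    push_cast
    ring
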